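/- A grading $R=\bigoplus_{g\in G}R_g$ of a unital real algebra $R$ by an abelian group $G$ (with $R_gR_h\subseteq R_{gh}$) is a *division grading* if every nonzero homogeneous element is invertible; its support is always assumed to be the whole of $G$. Gradings $R=\bigoplus_{g\in G}R_g$ and $S=\bigoplus_{h\in H}S_h$ are *weakly isomorphic* if there are an isomorphism of real algebras $\varphi:R\to S$ and an isomorphism of groups $\alpha:G\to H$ with $\varphi(R_g)=S_{\alpha(g)}$ for all $g\in G$. The tensor product $R\otimes_{\mathbb R} S$ is graded by $G\times H$ through $(R\otimes S)_{(g,h)}=R_g\otimes S_h$. Let $A=\begin{pmatrix}1&0\\0&-1\end{pmatrix}$, $B=\begin{pmatrix}0&1\\1&0\end{pmatrix}$, $C=AB=\begin{pmatrix}0&1\\-1&0\end{pmatrix}$ and $\omega=\frac{1}{\sqrt2}(1+i)$. Denote by * $M_2^{(4)}$ the algebra $M_2(\mathbb R)$ graded by $\mathbb Z_2\times\mathbb Z_2$, the component of degree $(a,b)$ being $\mathbb R\,A^aB^b$; * $\mathbb C^{(2)}$ the real algebra $\mathbb C$ graded by $\mathbb Z_2$, with components $\mathbb R$ and $\mathbb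 R i$; * $M_2^{(8)}$ the real algebra $M_2(\mathbb C)$ graded by $\mathbb Z_4\times\mathbb Z_2$, the component of degree $(a,b)$ being $\mathbb R\,(\omega A)^aC^b$; * $\mathbb H$ the real quaternion algebra with the trivial grading (by the trivial group). **Proposition.** Let $n\ge 0$ be an integer. The real algebra $M_n(\mathbb C)$ has a division grading by an abelian group with all components of dimension $4$ over $\mathbb R$ if and only if $n=2^m$ for some integer $m\ge 1$. For every such grading, the identity component $R_e$ is isomorphic to $\mathbb H$ as a real algebra, $n=2^{k+1}$ for some integer $k\ge 0$, and the grading is weakly isomorphic to one of the following: 1. $(M_2^{(4)})^{\otimes k}\otimes\mathbb C^{(2)}\otimes\mathbb H$; 2. $M_2^{(8)}\otimes (M_2^{(4)})^{\otimes (k-1)}\otimes\mathbb H$ (only if $k\ge 1$). -/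

import Mathlib

open scoped TensorProduct Quaternion

/-- A division grading of a (possibly noncommutative) real algebra `R` by an abelian group `G`,
written additively: `R` is the internal direct sum of the `𝒜 g`, `𝒜 g * 𝒜 h ⊆ 𝒜 (g + h)`, and
every nonzero homogeneous element is invertible. -/
structure IsDivisionGrading {G R : Type*} [AddCommGroup G] [Ring R] [Algebra ℝ R]
    (𝒜 : G → Submodule ℝ R) : Prop where
  gradedMonoid : SetLike.GradedMonoid 𝒜
  isInternal : open scoped Classical in DirectSum.IsInternal 𝒜
  isUnit : ∀ (g : G) (x : R), x ∈ 𝒜 g → x ≠ 0 → IsUnit x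

/-- Gradings of `R` by `G` and of `S` by `H` are weakly isomorphic if an isomorphism of algebras
`φ : R → S` and an isomorphism of groups `α : G → H` satisfy `φ (𝒜 g) = ℬ (α g)` for all `g`. -/
def WeaklyIsomorphic {G H R S : Type*} [AddCommGroup G] [AddCommGroup H]
    [Ring R] [Algebra ℝ R] [Ring S] [Algebra ℝ S]
    (𝒜 : G → Submodule ℝ R) (ℬ : H → Submodule ℝ S) : Prop :=
  ∃ (φ : R ≃ₐ[ℝ] S) (α : G ≃+ H), ∀ g : G, (𝒜 g).map φ.toLinearMap = ℬ (α g)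

/-- The tensor product of two gradings: the component of degree `(g, h)` of `R ⊗ S` is the
subspace `R_g ⊗ S_h`, spanned by the `x ⊗ y` with `x ∈ R_g` and `y ∈ S_h`. -/
def tensorGrading {G H R S : Type*} [Ring R] [Algebra ℝ R] [Ring S] [Algebra ℝ S]
    (𝒜 : G → Submodule ℝ R) (ℬ : H → Submodule ℝ S) : G × H → Submodule ℝ (R ⊗[ℝ] S) :=
  fun p => Submodule.span ℝ {z | ∃ x ∈ 𝒜 p.1, ∃ y ∈ ℬ p.2, z = x ⊗ₜ[ℝ] y}

/-- The `k`-th tensor power of a grading of `R` by `G`: a grading of `R ⊗ ⋯ ⊗ R` by `G × ⋯ × G`,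
whose component of degree `(g₁, …, g_k)` is `R_{g₁} ⊗ ⋯ ⊗ R_{g_k}`. -/
def tensorPowerGrading {G R : Type*} [Ring R] [Algebra ℝ R] (𝒜 : G → Submodule ℝ R) (k : ℕ) :
    (Fin k → G) → Submodule ℝ (⨂[ℝ] _ : Fin k, R) :=
  fun g => Submodule.span ℝ
    {z | ∃ x : Fin k → R, (∀ i, x i ∈ 𝒜 (g i)) ∧ z = PiTensorProduct.tprod ℝ x}

/-- The grading `M₂⁽⁴⁾` of `M₂(ℝ)` by `ℤ/2 × ℤ/2`. With `A = diag(1, -1)`, `B = [0 1; 1 0]` and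
`C = A B = [0 1; -1 0]`, the components of degree `(0,0)`, `(1,0)`, `(0,1)`, `(1,1)` are spanned by
`1`, `A`, `B`, `C` respectively. -/
noncomputable def gradingM2four : ZMod 2 × ZMod 2 → Submodule ℝ (Matrix (Fin 2) (Fin 2) ℝ) :=
  fun g => Submodule.span ℝ {!![1, 0; 0, -1] ^ g.1.val * !![0, 1; 1, 0] ^ g.2.val}

/-- The grading `ℂ⁽²⁾` of the real algebra `ℂ` by `ℤ/2`, with components `ℝ` and `ℝ i`. -/
noncomputable def gradingCtwo : ZMod 2 → Submodule ℝ ℂ :=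
  fun g => Submodule.span ℝ {Complex.I ^ g.val}

/-- The grading `M₂⁽⁸⁾` of the real algebra `M₂(ℂ)` by `ℤ/4 × ℤ/2`, with one-dimensional components.
With `ω = (1 + i) / √2`, `A = diag(1, -1)` and `C = [0 1; -1 0]`, the component of degree `(a, b)` is
spanned over `ℝ` by `(ω A) ^ a * C ^ b`. -/
noncomputable def gradingM2eight : ZMod 4 × ZMod 2 → Submodule ℝ (Matrix (Fin 2) (Fin 2) ℂ) :=
  fun g => Submodule.span ℝ
    {(((1 + Complex.I) / (Real.sqrt 2 : ℂ)) • !![1, 0; 0, -1]) ^ g.1.val *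
      !![0, 1; -1, 0] ^ g.2.val}

/-- The quaternions with the trivial grading (by the trivial group). -/
noncomputable def gradingH : Unit → Submodule ℝ ℍ[ℝ] :=
  fun _ => ⊤

/-!
The identity component of such a grading is a four-dimensional division algebra, hence a copy of
`ℍ` by Frobenius' theorem. A copy of a quaternion algebra in an algebra splits off as a tensor
factor, the other factor being its centralizer; if it is generated by homogeneous elements, the
centralizer is graded. Splitting off `ℍ` leaves a grading with one-dimensional components, which is
governed by the signs with which homogeneous elements commute. They form a bilinear form on the
grading group whose radical has order two, being the support of the centre `ℂ`, and multiplying by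
the central `i` adjusts the sign of the square of a homogeneous element. Thus a pair of
anticommuting homogeneous elements whose degrees have order two generates a copy of `M₂⁽⁴⁾`, which
splits off. When no such pair is left, the remaining grading is `ℂ⁽²⁾` or `M₂⁽⁸⁾`, the latter being
generated by a square root of `i` and an element anticommuting with it.
-/

/-- A pair of anticommuting elements with scalar squares generates a quaternion algebra. -/
def quaternionBasisOfAnticommute {K R : Type*} [CommRing K] [Ring R] [Algebra K R] {c₁ c₂ : K}
    {x y : R} (hx : x * x = c₁ • 1) (hy : y * y = c₂ • 1) (hxy : x * y = -(y * x)) :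
    QuaternionAlgebra.Basis R c₁ 0 c₂ where
  i := x
  j := y
  k := x * y
  i_mul_i := by simp [hx]
  j_mul_j := hy
  i_mul_j := rfl
  j_mul_i := by simp [hxy]

section Frobenius

variable {D : Type*} [Ring D] [Algebra ℝ D]

section Quadratic

variable [IsDomain D]

theorem exists_sub_algebraMap_sq_eq_neg_sq [Algebra.IsIntegral ℝ D] (x : D) :
    ∃ p s : ℝ, (x - algebraMap ℝ D p) ^ 2 = -algebraMap ℝ D s ^ 2 := by
  have hx : IsIntegral ℝ x := Algebra.IsIntegral.isIntegral x
  obtain ⟨z, hz⟩ := IsAlgClosed.exists_aeval_eq_zero ℂ (minpoly ℝ x) (minpoly.degree_pos hx).ne'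
  have hminpoly : minpoly ℝ x = minpoly ℝ z :=
    minpoly.eq_of_irreducible_of_monic (minpoly.irreducible hx) hz (minpoly.monic hx)
  let P : Polynomial ℝ := (.X - .C z.re) ^ 2 + .C z.im ^ 2
  have hPz : Polynomial.aeval z P = 0 := by
    apply Complex.ext <;> simp [P, pow_two]
  have hPx : Polynomial.aeval x P = 0 :=
    Polynomial.aeval_eq_zero_of_dvd_aeval_eq_zero (hminpoly ▸ minpoly.dvd ℝ z hPz)
      (minpoly.aeval ℝ x)
  exact ⟨z.re, z.im, eq_neg_of_add_eq_zero_left (by simpa [P] using hPx)⟩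

theorem exists_smul_sq_eq_neg_one {y : D} (hy : y ≠ 0) {s : ℝ}
    (h : y ^ 2 = -algebraMap ℝ D s ^ 2) : ∃ r : ℝ, (r • y) ^ 2 = -1 := by
  have hs : s ≠ 0 := by
    rintro rfl
    simp [hy] at h
  refine ⟨s⁻¹, ?_⟩
  rw [smul_pow, h, ← map_pow, smul_neg, Algebra.smul_def, ← map_mul, ← mul_pow,
    inv_mul_cancel₀ hs, one_pow, map_one]

variable [Algebra.IsIntegral ℝ D]

theorem exists_sq_eq_neg_one_of_notMem_range_algebraMap {x : D}
    (hx : x ∉ Set.range (algebraMap ℝ D)) : ∃ i : D, i ^ 2 = -1 := by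
  obtain ⟨p, s, hps⟩ := exists_sub_algebraMap_sq_eq_neg_sq x
  obtain ⟨r, hr⟩ := exists_smul_sq_eq_neg_one (sub_ne_zero.mpr fun h => hx ⟨p, h.symm⟩) hps
  exact ⟨_, hr⟩

theorem mem_span_one_pair_of_commute {i w : D} (hi : i ^ 2 = -1) (hw : Commute w i) :
    w ∈ Submodule.span ℝ {1, i} := by
  obtain ⟨p, s, hps⟩ := exists_sub_algebraMap_sq_eq_neg_sq w
  have hcomm : Commute (w - algebraMap ℝ D p) (s • i) :=
    (hw.sub_left (Algebra.commutes p i)).smul_right s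
  have hsq : (w - algebraMap ℝ D p) ^ 2 = (s • i) ^ 2 := by
    rw [hps, smul_pow, hi, smul_neg, Algebra.smul_def, mul_one, map_pow]
  rw [Submodule.mem_span_pair]
  obtain h | h := hcomm.sq_eq_sq_iff_eq_or_eq_neg.mp hsq
  · exact ⟨p, s, by rw [← h, Algebra.smul_def, mul_one, add_sub_cancel]⟩
  · exact ⟨p, -s, by rw [neg_smul, ← h, Algebra.smul_def, mul_one, add_sub_cancel]⟩

theorem exists_smul_sq_eq_neg_one_of_anticommute {i u : D} (hi : i ≠ 0) (hu : u ≠ 0)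
    (hui : u * i = -(i * u)) : ∃ r : ℝ, (r • u) ^ 2 = -1 := by
  obtain ⟨p, s, hps⟩ := exists_sub_algebraMap_sq_eq_neg_sq u
  have hsq : u ^ 2 = (2 * p) • u - (p ^ 2 + s ^ 2) • 1 := by
    simp only [Algebra.algebraMap_eq_smul_one, pow_two, sub_mul, mul_sub, smul_mul_assoc,
      mul_smul_comm, one_mul, mul_one] at hps ⊢
    linear_combination (norm := module) hps
  have hcomm : u ^ 2 * i = i * u ^ 2 := by
    rw [pow_two, mul_assoc, hui, mul_neg, ← mul_assoc, hui, neg_mul, neg_neg, mul_assoc]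
  have hp : (4 * p) • (i * u) = 0 := by
    rw [hsq, sub_mul, mul_sub, smul_mul_assoc, hui] at hcomm
    simp only [smul_mul_assoc, mul_smul_comm, one_mul, mul_one] at hcomm
    linear_combination (norm := module) -hcomm
  obtain rfl : p = 0 := by simpa [hi, hu] using hp
  exact exists_smul_sq_eq_neg_one hu (by simpa using hps)

end Quadratic

theorem exists_notMem_span_pair {K V : Type*} [DivisionRing K] [AddCommGroup V] [Module K V]
    (hV : 2 < Module.finrank K V) (y z : V) : ∃ x : V, x ∉ Submodule.span K {y, z} := by
  classical
  by_contra! hall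
  have htop : Submodule.span K (({y, z} : Finset V) : Set V) = ⊤ :=
    Submodule.eq_top_iff'.mpr fun x => by simpa using hall x
  have hle := finrank_span_finset_le_card (R := K) ({y, z} : Finset V)
  rw [Set.finrank, htop, finrank_top] at hle
  exact absurd (hle.trans Finset.card_le_two) hV.not_ge

theorem exists_anticommute_of_notMem_span {i w : D} [IsDomain D] [Algebra.IsIntegral ℝ D]
    (hi : i ^ 2 = -1) (hw : w ∉ Submodule.span ℝ {1, i}) : ∃ u : D, u ≠ 0 ∧ u * i = -(i * u) := by
  refine ⟨w + i * w * i, fun h0 => hw (mem_span_one_pair_of_commute hi ?_), ?_⟩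
  · have h := congrArg (· * i) h0
    simp only [add_mul, mul_assoc, ← pow_two, hi, zero_mul] at h
    simpa [Commute, SemiconjBy, ← sub_eq_add_neg, sub_eq_zero] using h
  · simp only [add_mul, mul_add, mul_assoc, ← pow_two, hi]
    simp only [← mul_assoc, ← pow_two, hi]
    noncomm_ring

theorem exists_quaternion_algHom_bijective [IsDomain D] (h4 : Module.finrank ℝ D = 4) :
    ∃ f : ℍ[ℝ] →ₐ[ℝ] D, Function.Bijective f := by
  have : FiniteDimensional ℝ D := Module.finite_of_finrank_eq_succ h4
  obtain ⟨x, hx⟩ := exists_notMem_span_pair (K := ℝ) (by omega) (1 : D) 0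
  obtain ⟨i, hi⟩ := exists_sq_eq_neg_one_of_notMem_range_algebraMap (x := x) <| by
    rintro ⟨p, rfl⟩
    exact hx (Submodule.mem_span_pair.mpr ⟨p, 0, by simp [Algebra.smul_def]⟩)
  obtain ⟨w, hw⟩ := exists_notMem_span_pair (K := ℝ) (by omega) (1 : D) i
  obtain ⟨u, hu, hui⟩ := exists_anticommute_of_notMem_span hi hw
  have hi0 : i ≠ 0 := by rintro rfl; simp at hi
  obtain ⟨r, hr⟩ := exists_smul_sq_eq_neg_one_of_anticommute hi0 hu hui
  let q : QuaternionAlgebra.Basis D (-1 : ℝ) 0 (-1) :=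
    quaternionBasisOfAnticommute (x := i) (y := r • u) (by simp [← pow_two, hi])
      (by rw [← pow_two, hr, neg_one_smul]) (by simp [hui])
  let f : ℍ[ℝ] →ₐ[ℝ] D := q.liftHom
  have hinj : Function.Injective f := (f : ℍ[ℝ] →+* D).injective
  exact ⟨f, hinj, (LinearMap.injective_iff_surjective_of_finrank_eq_finrank
    (f := f.toLinearMap) (by rw [h4, Quaternion.finrank_eq_four])).mp hinj⟩

end Frobenius

section DivisionGradings

variable {G R : Type*} [AddCommGroup G] [Ring R] [Algebra ℝ R] {𝒜 : G → Submodule ℝ R}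

namespace IsDivisionGrading

theorem one_mem (h : IsDivisionGrading 𝒜) : (1 : R) ∈ 𝒜 0 :=
  h.gradedMonoid.one_mem

theorem mul_mem (h : IsDivisionGrading 𝒜) {g g' : G} {x y : R} (hx : x ∈ 𝒜 g) (hy : y ∈ 𝒜 g') :
    x * y ∈ 𝒜 (g + g') :=
  h.gradedMonoid.mul_mem hx hy

theorem pow_mem (h : IsDivisionGrading 𝒜) {g : G} {x : R} (hx : x ∈ 𝒜 g) (n : ℕ) :
    x ^ n ∈ 𝒜 (n • g) := by
  induction n with
  | zero => simpa using h.one_mem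
  | succ n ih =>
    rw [pow_succ, succ_nsmul]
    exact h.mul_mem ih hx

theorem iSupIndep (h : IsDivisionGrading 𝒜) : iSupIndep 𝒜 := by
  classical exact h.isInternal.submodule_iSupIndep

theorem iSup_eq_top (h : IsDivisionGrading 𝒜) : ⨆ g, 𝒜 g = ⊤ := by
  classical exact h.isInternal.submodule_iSup_eq_top

theorem eq_zero_of_eq_add (h : IsDivisionGrading 𝒜) {g g₁ g₂ : G} {x y z : R} (hx : x ∈ 𝒜 g)
    (hy : y ∈ 𝒜 g₁) (hz : z ∈ 𝒜 g₂) (h₁ : g₁ ≠ g) (h₂ : g₂ ≠ g) (hxyz : x = y + z) : x = 0 := by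
  refine Submodule.disjoint_def.mp (h.iSupIndep g) x hx ?_
  rw [hxyz]
  exact add_mem (Submodule.mem_iSup_of_mem g₁ (Submodule.mem_iSup_of_mem h₁ hy))
    (Submodule.mem_iSup_of_mem g₂ (Submodule.mem_iSup_of_mem h₂ hz))

theorem degree_eq (h : IsDivisionGrading 𝒜) {g g' : G} {x : R} (hx : x ∈ 𝒜 g) (hx' : x ∈ 𝒜 g')
    (hx0 : x ≠ 0) : g = g' := by
  by_contra hne
  exact hx0 (h.eq_zero_of_eq_add hx hx' (zero_mem (𝒜 g')) (Ne.symm hne) (Ne.symm hne)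
    (add_zero x).symm)

theorem finite (h : IsDivisionGrading 𝒜) [FiniteDimensional ℝ R] (hne : ∀ g, 𝒜 g ≠ ⊥) :
    Finite G := by
  have := WellFoundedGT.finite_ne_bot_of_iSupIndep h.iSupIndep
  simpa [hne, Set.finite_univ_iff] using this

theorem sum_finrank (h : IsDivisionGrading 𝒜) [Fintype G] [FiniteDimensional ℝ R] :
    ∑ g, Module.finrank ℝ (𝒜 g) = Module.finrank ℝ R := by
  classical
  rw [← (LinearEquiv.ofBijective (DirectSum.coeLinearMap 𝒜) h.isInternal).finrank_eq,
    Module.finrank_directSum]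

theorem exists_quaternion_algHom (h : IsDivisionGrading 𝒜)
    (h4 : Module.finrank ℝ (𝒜 0) = 4) :
    ∃ f : ℍ[ℝ] →ₐ[ℝ] R, Function.Injective f ∧ LinearMap.range f.toLinearMap = 𝒜 0 := by
  let D : Subalgebra ℝ R := (𝒜 0).toSubalgebra h.one_mem fun x y hx hy => by
    simpa using h.mul_mem hx hy
  have hD : Module.finrank ℝ D = 4 := h4
  have : Nontrivial D := Module.nontrivial_of_finrank_pos (R := ℝ) (by omega)
  have : NoZeroDivisors D := ⟨fun {a b} hab => by
    by_contra! hne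
    have ha := h.isUnit 0 a a.2 (by simpa using hne.1)
    exact hne.2 (Subtype.ext (ha.mul_right_eq_zero.mp (congrArg Subtype.val hab)))⟩
  have : IsDomain D := NoZeroDivisors.to_isDomain D
  obtain ⟨f, hinj, hsurj⟩ := exists_quaternion_algHom_bijective hD
  refine ⟨D.val.comp f, Subtype.val_injective.comp hinj, le_antisymm ?_ ?_⟩
  · rintro _ ⟨q, rfl⟩
    exact (f q).2
  · intro x hx
    obtain ⟨q, hq⟩ := hsurj ⟨x, hx⟩
    exact ⟨q, congrArg Subtype.val hq⟩

end IsDivisionGrading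

end DivisionGradings

section WeakIsomorphisms

theorem eq_of_le_of_iSupIndep_of_iSup_eq_top {ι α : Type*} [CompleteLattice α]
    [IsModularLattice α] {s t : ι → α} (hst : s ≤ t) (ht : iSupIndep t) (hs : ⨆ i, s i = ⊤) :
    s = t := by
  funext i
  have htop : s i ⊔ ⨆ (j) (_ : j ≠ i), t j = ⊤ := by
    refine top_le_iff.mp (hs ▸ iSup_le fun j => ?_)
    obtain rfl | hj := eq_or_ne j i
    · exact le_sup_left
    · exact (hst j).trans (le_sup_of_le_right (le_iSup₂_of_le j hj le_rfl))
  calc s i = s i ⊔ (⨆ (j) (_ : j ≠ i), t j) ⊓ t i := by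
        rw [(ht i).symm.eq_bot, sup_bot_eq]
    _ = (s i ⊔ ⨆ (j) (_ : j ≠ i), t j) ⊓ t i := (sup_inf_assoc_of_le _ (hst i)).symm
    _ = t i := by rw [htop, top_inf_eq]

theorem iSupIndep_of_injective_of_mapsTo {ι K M N : Type*} [Ring K] [AddCommGroup M] [Module K M]
    [AddCommGroup N] [Module K N] {s : ι → Submodule K M} {t : ι → Submodule K N}
    (f : M →ₗ[K] N) (hf : Function.Injective f) (hst : ∀ i, ∀ x ∈ s i, f x ∈ t i)
    (ht : iSupIndep t) : iSupIndep s := by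
  rw [iSupIndep_iff_finsetSum_eq_zero_imp_eq_zero] at ht ⊢
  intro F v hv hsum i hi
  exact hf ((ht F (fun i => f (v i)) (fun i hi => hst i _ (hv i hi))
    (by rw [← map_sum, hsum, map_zero]) i hi).trans (map_zero f).symm)

namespace WeaklyIsomorphic

variable {G H K R S T : Type*} [AddCommGroup G] [AddCommGroup H] [AddCommGroup K]
  [Ring R] [Algebra ℝ R] [Ring S] [Algebra ℝ S] [Ring T] [Algebra ℝ T]
  {𝒜 : G → Submodule ℝ R} {ℬ : H → Submodule ℝ S} {𝒞 : K → Submodule ℝ T}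

theorem of_forall_mem (φ : R ≃ₐ[ℝ] S) (α : G ≃+ H)
    (h : ∀ g, ∀ x ∈ 𝒜 g, φ x ∈ ℬ (α g))
    (h' : ∀ g, ∀ y ∈ ℬ g, φ.symm y ∈ 𝒜 (α.symm g)) : WeaklyIsomorphic 𝒜 ℬ :=
  ⟨φ, α, fun g => le_antisymm (Submodule.map_le_iff_le_comap.mpr (h g)) fun y hy =>
    ⟨φ.symm y, by simpa using h' (α g) y hy, φ.apply_symm_apply y⟩⟩

theorem of_iSup_eq_top (φ : R ≃ₐ[ℝ] S) (α : G ≃+ H) (h : ∀ g, ∀ x ∈ 𝒜 g, φ x ∈ ℬ (α g))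
    (h𝒜 : ⨆ g, 𝒜 g = ⊤) (hℬ : iSupIndep ℬ) : WeaklyIsomorphic 𝒜 ℬ := by
  refine ⟨φ, α, congrFun (eq_of_le_of_iSupIndep_of_iSup_eq_top
    (fun g => Submodule.map_le_iff_le_comap.mpr (h g)) (hℬ.comp α.injective) ?_)⟩
  rw [← Submodule.map_iSup, h𝒜, Submodule.map_top]
  exact LinearMap.range_eq_top.mpr φ.surjective

theorem refl (𝒜 : G → Submodule ℝ R) : WeaklyIsomorphic 𝒜 𝒜 :=
  ⟨.refl, .refl G, fun g => Submodule.map_id (𝒜 g)⟩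

theorem symm (h : WeaklyIsomorphic 𝒜 ℬ) : WeaklyIsomorphic ℬ 𝒜 := by
  obtain ⟨φ, α, h⟩ := h
  refine ⟨φ.symm, α.symm, fun g => ?_⟩
  obtain ⟨g, rfl⟩ := α.surjective g
  have hφ : φ.symm.toLinearMap ∘ₗ φ.toLinearMap = .id := LinearMap.ext φ.symm_apply_apply
  rw [← h g, ← Submodule.map_comp, hφ, Submodule.map_id, α.symm_apply_apply]

theorem trans (h : WeaklyIsomorphic 𝒜 ℬ) (h' : WeaklyIsomorphic ℬ 𝒞) : WeaklyIsomorphic 𝒜 𝒞 := by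
  obtain ⟨φ, α, h⟩ := h
  obtain ⟨ψ, β, h'⟩ := h'
  refine ⟨φ.trans ψ, α.trans β, fun g => ?_⟩
  rw [AddEquiv.trans_apply, ← h', ← h, ← Submodule.map_comp]
  rfl

theorem map_algEquiv (𝒜 : G → Submodule ℝ R) (φ : R ≃ₐ[ℝ] S) :
    WeaklyIsomorphic 𝒜 fun g => (𝒜 g).map φ.toLinearMap :=
  ⟨φ, .refl G, fun _ => rfl⟩

theorem finrank_eq {d : ℕ} (h : WeaklyIsomorphic 𝒜 ℬ)
    (hd : ∀ g, Module.finrank ℝ (𝒜 g) = d) (g : H) : Module.finrank ℝ (ℬ g) = d := by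
  obtain ⟨φ, α, h⟩ := h
  obtain ⟨g, rfl⟩ := α.surjective g
  rw [← h g, ← hd g]
  exact LinearEquiv.finrank_map_eq φ.toLinearEquiv (𝒜 g)

theorem isDivisionGrading (h : WeaklyIsomorphic 𝒜 ℬ) (h𝒜 : IsDivisionGrading 𝒜) :
    IsDivisionGrading ℬ := by
  classical
  obtain ⟨φ, α, h⟩ := h.symm
  have hmem {g : H} {x : S} : x ∈ ℬ g ↔ φ x ∈ 𝒜 (α g) := by
    simp [← h g]
  have hindep : iSupIndep ℬ :=
    iSupIndep_of_injective_of_mapsTo φ.toLinearMap φ.injective (fun g x => hmem.mp)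
      (h𝒜.iSupIndep.comp α.injective)
  have htop : ⨆ g, ℬ g = ⊤ := by
    refine Submodule.map_injective_of_injective (f := φ.toLinearMap) φ.injective ?_
    rw [Submodule.map_iSup, Submodule.map_top, LinearMap.range_eq_top.mpr φ.surjective]
    simp only [h, α.surjective.iSup_comp, h𝒜.iSup_eq_top]
  exact
    { gradedMonoid :=
        { one_mem := hmem.mpr (by simpa using h𝒜.one_mem)
          mul_mem := fun g g' x y hx hy =>
            hmem.mpr (by simpa using h𝒜.mul_mem (hmem.mp hx) (hmem.mp hy)) }
      isInternal := DirectSum.isInternal_submodule_of_iSupIndep_of_iSup_eq_top hindep htop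
      isUnit := fun g x hx hx0 => by
        simpa using (h𝒜.isUnit (α g) (φ x) (hmem.mp hx) (by simpa using hx0)).map φ.symm }

end WeaklyIsomorphic

end WeakIsomorphisms

section TensorProducts

variable {G H K R S T : Type*} [Ring R] [Algebra ℝ R] [Ring S] [Algebra ℝ S] [Ring T] [Algebra ℝ T]
  {𝒜 : G → Submodule ℝ R} {ℬ : H → Submodule ℝ S} {𝒞 : K → Submodule ℝ T}

theorem tmul_mem_tensorGrading {g : G} {h : H} {x : R} {y : S} (hx : x ∈ 𝒜 g) (hy : y ∈ ℬ h) :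
    x ⊗ₜ[ℝ] y ∈ tensorGrading 𝒜 ℬ (g, h) :=
  Submodule.subset_span ⟨x, hx, y, hy, rfl⟩

theorem map_mem_of_mem_tensorGrading {M : Type*} [AddCommGroup M] [Module ℝ M]
    {f : R ⊗[ℝ] S →ₗ[ℝ] M} {N : Submodule ℝ M} {p : G × H}
    (hf : ∀ x ∈ 𝒜 p.1, ∀ y ∈ ℬ p.2, f (x ⊗ₜ y) ∈ N) :
    ∀ z ∈ tensorGrading 𝒜 ℬ p, f z ∈ N := by
  refine fun z hz => (Submodule.span_le (p := N.comap f)).mpr ?_ hz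
  rintro _ ⟨x, hx, y, hy, rfl⟩
  exact hf x hx y hy

theorem tensorGrading_eq_map₂ (𝒜 : G → Submodule ℝ R) (ℬ : H → Submodule ℝ S) (p : G × H) :
    tensorGrading 𝒜 ℬ p = Submodule.map₂ (TensorProduct.mk ℝ R S) (𝒜 p.1) (ℬ p.2) := by
  refine le_antisymm (Submodule.span_le.mpr ?_) (Submodule.map₂_le.mpr ?_)
  · rintro _ ⟨x, hx, y, hy, rfl⟩
    exact Submodule.apply_mem_map₂ _ hx hy
  · exact fun x hx y hy => tmul_mem_tensorGrading hx hy

theorem iSup_tensorGrading_eq_top (h𝒜 : ⨆ g, 𝒜 g = ⊤) (hℬ : ⨆ h, ℬ h = ⊤) :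
    ⨆ p, tensorGrading 𝒜 ℬ p = ⊤ := by
  simp only [tensorGrading_eq_map₂, iSup_prod, ← Submodule.map₂_iSup_right,
    ← Submodule.map₂_iSup_left, h𝒜, hℬ, TensorProduct.map₂_mk_top_top_eq_top]

theorem finrank_tensorGrading (𝒜 : G → Submodule ℝ R) (ℬ : H → Submodule ℝ S) (p : G × H) :
    Module.finrank ℝ (tensorGrading 𝒜 ℬ p) =
      Module.finrank ℝ (𝒜 p.1) * Module.finrank ℝ (ℬ p.2) := by
  rw [tensorGrading_eq_map₂, ← TensorProduct.range_mapIncl, ← Module.finrank_tensorProduct]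
  exact LinearMap.finrank_range_of_inj (TensorProduct.map_injective_of_flat_flat _ _
    (Submodule.subtype_injective _) (Submodule.subtype_injective _))

theorem tprod_mem_tensorPowerGrading {k : ℕ} {g : Fin k → G} {x : Fin k → R}
    (hx : ∀ i, x i ∈ 𝒜 (g i)) : PiTensorProduct.tprod ℝ x ∈ tensorPowerGrading 𝒜 k g :=
  Submodule.subset_span ⟨x, hx, rfl⟩

theorem map_mem_of_mem_tensorPowerGrading {M : Type*} [AddCommGroup M] [Module ℝ M] {k : ℕ}
    {f : (⨂[ℝ] _ : Fin k, R) →ₗ[ℝ] M} {N : Submodule ℝ M} {g : Fin k → G}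
    (hf : ∀ x : Fin k → R, (∀ i, x i ∈ 𝒜 (g i)) → f (PiTensorProduct.tprod ℝ x) ∈ N) :
    ∀ z ∈ tensorPowerGrading 𝒜 k g, f z ∈ N := by
  refine fun z hz => (Submodule.span_le (p := N.comap f)).mpr ?_ hz
  rintro _ ⟨x, hx, rfl⟩
  exact hf x hx

namespace WeaklyIsomorphic

variable [AddCommGroup G] [AddCommGroup H] [AddCommGroup K]

theorem tensor {G' H' R' S' : Type*} [AddCommGroup G'] [AddCommGroup H'] [Ring R'] [Algebra ℝ R']
    [Ring S'] [Algebra ℝ S'] {𝒜' : G' → Submodule ℝ R'} {ℬ' : H' → Submodule ℝ S'}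
    (h𝒜 : WeaklyIsomorphic 𝒜 𝒜') (hℬ : WeaklyIsomorphic ℬ ℬ') :
    WeaklyIsomorphic (tensorGrading 𝒜 ℬ) (tensorGrading 𝒜' ℬ') := by
  obtain ⟨φ, α, hφ⟩ := h𝒜
  obtain ⟨ψ, β, hψ⟩ := hℬ
  refine ⟨Algebra.TensorProduct.congr φ ψ, α.prodCongr β, fun p => ?_⟩
  simp only [tensorGrading_eq_map₂, Submodule.map_map₂]
  change _ = Submodule.map₂ _ (𝒜' (α p.1)) (ℬ' (β p.2))
  rw [← hφ, ← hψ, Submodule.map₂_map_map]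
  rfl

theorem tensor_comm (𝒜 : G → Submodule ℝ R) (ℬ : H → Submodule ℝ S) :
    WeaklyIsomorphic (tensorGrading 𝒜 ℬ) (tensorGrading ℬ 𝒜) :=
  of_forall_mem (Algebra.TensorProduct.comm ℝ R S) .prodComm
    (fun _ => map_mem_of_mem_tensorGrading (f := (Algebra.TensorProduct.comm ℝ R S).toLinearMap)
      fun _ hx _ hy => tmul_mem_tensorGrading hy hx)
    (fun _ => map_mem_of_mem_tensorGrading
      (f := (Algebra.TensorProduct.comm ℝ R S).symm.toLinearMap)
      fun _ hx _ hy => tmul_mem_tensorGrading hy hx)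

theorem tensor_assoc (𝒜 : G → Submodule ℝ R) (ℬ : H → Submodule ℝ S) (𝒞 : K → Submodule ℝ T) :
    WeaklyIsomorphic (tensorGrading (tensorGrading 𝒜 ℬ) 𝒞)
      (tensorGrading 𝒜 (tensorGrading ℬ 𝒞)) := by
  let φ := Algebra.TensorProduct.assoc ℝ ℝ ℝ R S T
  refine of_forall_mem φ .prodAssoc (fun p => map_mem_of_mem_tensorGrading (f := φ.toLinearMap)
    fun u hu z hz => ?_) (fun p => map_mem_of_mem_tensorGrading (f := φ.symm.toLinearMap)
    fun x hx v hv => ?_)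
  · exact map_mem_of_mem_tensorGrading
      (f := φ.toLinearMap ∘ₗ (TensorProduct.mk ℝ (R ⊗[ℝ] S) T).flip z)
      (fun x hx y hy => tmul_mem_tensorGrading hx (tmul_mem_tensorGrading hy hz)) u hu
  · exact map_mem_of_mem_tensorGrading
      (f := φ.symm.toLinearMap ∘ₗ TensorProduct.mk ℝ R (S ⊗[ℝ] T) x)
      (fun y hy z hz => tmul_mem_tensorGrading (tmul_mem_tensorGrading hx hy) hz) v hv

theorem tensor_right_comm (𝒜 : G → Submodule ℝ R) (ℬ : H → Submodule ℝ S)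
    (𝒞 : K → Submodule ℝ T) :
    WeaklyIsomorphic (tensorGrading (tensorGrading 𝒜 ℬ) 𝒞)
      (tensorGrading (tensorGrading 𝒜 𝒞) ℬ) :=
  (tensor_assoc 𝒜 ℬ 𝒞).trans (((refl 𝒜).tensor (tensor_comm ℬ 𝒞)).trans (tensor_assoc 𝒜 𝒞 ℬ).symm)

end WeaklyIsomorphic

/-- The tensor product of an empty family of copies of `R` is the base field. -/
noncomputable def emptyTensorPowerAlgEquiv (R : Type*) [Ring R] [Algebra ℝ R] :
    (⨂[ℝ] _ : Fin 0, R) ≃ₐ[ℝ] ℝ :=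
  AlgEquiv.ofLinearEquiv (PiTensorProduct.isEmptyEquiv (Fin 0))
    (PiTensorProduct.isEmptyEquiv_apply_tprod _ _) (LinearMap.map_mul_iff _ |>.mpr <| by ext; simp)

/-- The last factor of a tensor power is split off. -/
noncomputable def tensorPowerSuccAlgEquiv (R : Type*) [Ring R] [Algebra ℝ R] (k : ℕ) :
    (⨂[ℝ] _ : Fin (k + 1), R) ≃ₐ[ℝ] (⨂[ℝ] _ : Fin k, R) ⊗[ℝ] R :=
  AlgEquiv.ofLinearEquiv
    (PiTensorProduct.reindex ℝ (fun _ => R) finSumFinEquiv.symm ≪≫ₗ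
      (PiTensorProduct.tmulEquiv ℝ R).symm ≪≫ₗ
      TensorProduct.congr (.refl ℝ _) (PiTensorProduct.subsingletonEquiv (0 : Fin 1)))
    (by
      simp only [PiTensorProduct.one_def, LinearEquiv.trans_apply, PiTensorProduct.reindex_tprod,
        PiTensorProduct.tmulEquiv_symm_apply, TensorProduct.congr_tmul,
        PiTensorProduct.subsingletonEquiv_apply_tprod]
      rfl)
    (LinearMap.map_mul_iff _ |>.mpr <| by
      ext
      simp only [LinearMap.compMultilinearMap_apply, LinearMap.compr₂_apply,
        LinearMap.mul_apply_apply, PiTensorProduct.tprod_mul_tprod, LinearEquiv.coe_coe,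
        LinearEquiv.trans_apply, PiTensorProduct.reindex_tprod,
        PiTensorProduct.tmulEquiv_symm_apply, TensorProduct.congr_tmul, LinearEquiv.refl_apply,
        PiTensorProduct.subsingletonEquiv_apply_tprod, LinearMap.compl₂_apply,
        LinearMap.coe_comp, Function.comp_apply, Algebra.TensorProduct.tmul_mul_tmul]
      rfl)

theorem tensorPowerSuccAlgEquiv_tprod {k : ℕ} (x : Fin (k + 1) → R) :
    tensorPowerSuccAlgEquiv R k (PiTensorProduct.tprod ℝ x) =
      PiTensorProduct.tprod ℝ (Fin.init x) ⊗ₜ x (Fin.last k) := by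
  simp only [tensorPowerSuccAlgEquiv, AlgEquiv.ofLinearEquiv_apply, LinearEquiv.trans_apply,
    PiTensorProduct.reindex_tprod, PiTensorProduct.tmulEquiv_symm_apply, TensorProduct.congr_tmul,
    LinearEquiv.refl_apply, PiTensorProduct.subsingletonEquiv_apply_tprod]
  rfl

namespace WeaklyIsomorphic

variable [AddCommGroup G] [AddCommGroup H]

theorem tensorPower_succ (𝒜 : G → Submodule ℝ R) (k : ℕ) :
    WeaklyIsomorphic (tensorPowerGrading 𝒜 (k + 1))
      (tensorGrading (tensorPowerGrading 𝒜 k) 𝒜) := by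
  let φ := tensorPowerSuccAlgEquiv R k
  let α : (Fin (k + 1) → G) ≃+ (Fin k → G) × G :=
    { toFun := fun g => (Fin.init g, g (Fin.last k))
      invFun := fun p => Fin.snoc p.1 p.2
      left_inv := fun g => Fin.snoc_init_self g
      right_inv := fun p => by simp
      map_add' := fun _ _ => rfl }
  refine of_forall_mem φ α (fun g => map_mem_of_mem_tensorPowerGrading (f := φ.toLinearMap)
    fun x hx => ?_) (fun p => map_mem_of_mem_tensorGrading (f := φ.symm.toLinearMap)
    fun u hu y hy => ?_)
  · exact (tensorPowerSuccAlgEquiv_tprod x).symm ▸ tmul_mem_tensorGrading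
      (tprod_mem_tensorPowerGrading fun i => hx i.castSucc) (hx (Fin.last k))
  · refine map_mem_of_mem_tensorPowerGrading
      (f := φ.symm.toLinearMap ∘ₗ (TensorProduct.mk ℝ (⨂[ℝ] _ : Fin k, R) R).flip y)
      (fun x hx => ?_) u hu
    have hφ : φ.symm (PiTensorProduct.tprod ℝ x ⊗ₜ y) =
        PiTensorProduct.tprod ℝ (Fin.snoc x y : Fin (k + 1) → R) := by
      rw [AlgEquiv.symm_apply_eq, tensorPowerSuccAlgEquiv_tprod, Fin.init_snoc, Fin.snoc_last]
    have hα : α.symm p = Fin.snoc p.1 p.2 := rfl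
    refine hφ.symm ▸ tprod_mem_tensorPowerGrading fun i => ?_
    induction i using Fin.lastCases with
    | last => simpa [hα] using hy
    | cast i => simpa [hα] using hx i

theorem tensor_tensorPower_zero (𝒜 : G → Submodule ℝ R) (ℬ : H → Submodule ℝ S) :
    WeaklyIsomorphic (tensorGrading ℬ (tensorPowerGrading 𝒜 0)) ℬ := by
  let φ : S ⊗[ℝ] (⨂[ℝ] _ : Fin 0, R) ≃ₐ[ℝ] S :=
    (Algebra.TensorProduct.congr .refl (emptyTensorPowerAlgEquiv R)).trans
      (Algebra.TensorProduct.rid ℝ ℝ S)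
  refine of_forall_mem φ .prodUnique (fun p => map_mem_of_mem_tensorGrading (f := φ.toLinearMap)
    fun y hy u _ => ?_) (fun h y hy => ?_)
  · exact (ℬ p.1).smul_mem (emptyTensorPowerAlgEquiv R u) hy
  · have hφ : φ.symm y = y ⊗ₜ 1 := by simp [φ]
    rw [hφ, PiTensorProduct.one_def]
    exact tmul_mem_tensorGrading hy (tprod_mem_tensorPowerGrading fun i => i.elim0)

end WeaklyIsomorphic

end TensorProducts

section TwistedGroupAlgebras

variable {G H R S : Type*} [AddCommGroup G] [AddCommGroup H] [Ring R] [Algebra ℝ R]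
  [Ring S] [Algebra ℝ S] {𝒜 : G → Submodule ℝ R} {ℬ : H → Submodule ℝ S}

/-- A division grading with one-dimensional components. Choosing a nonzero element in every
component, such an algebra is the group algebra of `G` with multiplication twisted by a
2-cocycle. -/
structure IsTwistedGroupAlgebra (𝒜 : G → Submodule ℝ R) : Prop extends IsDivisionGrading 𝒜 where
  finrank_eq_one : ∀ g, Module.finrank ℝ (𝒜 g) = 1

theorem isTwistedGroupAlgebra_span_singleton [Finite G] [Nontrivial R] {u : G → R}
    (hu : ∀ g, IsUnit (u g)) (hone : u 0 = 1) (hmul : ∀ g g', ∃ c : ℝ, u g * u g' = c • u (g + g'))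
    (hspan : ⊤ ≤ Submodule.span ℝ (Set.range u)) (hcard : Nat.card G = Module.finrank ℝ R) :
    IsTwistedGroupAlgebra fun g => Submodule.span ℝ {u g} := by
  classical
  cases nonempty_fintype G
  have hli : LinearIndependent ℝ u :=
    linearIndependent_of_top_le_span_of_card_eq_finrank hspan (by rwa [← Nat.card_eq_fintype_card])
  refine
    { gradedMonoid :=
        { one_mem := hone ▸ Submodule.mem_span_singleton_self (u 0)
          mul_mem := fun g g' x y hx hy => ?_ }
      isInternal := DirectSum.isInternal_submodule_of_iSupIndep_of_iSup_eq_top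
        hli.iSupIndep_span_singleton ?_
      isUnit := fun g x hx hx0 => ?_
      finrank_eq_one := fun g => finrank_span_singleton (hu g).ne_zero }
  · obtain ⟨a, rfl⟩ := Submodule.mem_span_singleton.mp hx
    obtain ⟨b, rfl⟩ := Submodule.mem_span_singleton.mp hy
    obtain ⟨c, hc⟩ := hmul g g'
    rw [smul_mul_smul_comm, hc]
    exact Submodule.smul_mem _ _ (Submodule.smul_mem _ _ (Submodule.mem_span_singleton_self _))
  · rw [← Submodule.span_range_eq_iSup, top_le_iff.mp hspan]
  · obtain ⟨a, rfl⟩ := Submodule.mem_span_singleton.mp hx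
    exact (hu g).smul (Units.mk0 a (left_ne_zero_of_smul hx0))

theorem isInternal_of_iSup_eq_top_of_sum_finrank {ι K M : Type*} [Fintype ι] [DivisionRing K]
    [AddCommGroup M] [Module K M] [FiniteDimensional K M] {s : ι → Submodule K M}
    (hs : ⨆ i, s i = ⊤) (hsum : ∑ i, Module.finrank K (s i) = Module.finrank K M) :
    open scoped Classical in DirectSum.IsInternal s := by
  classical
  have hsurj : Function.Surjective (DirectSum.coeLinearMap s) := by
    rw [← LinearMap.range_eq_top, ← hs, Submodule.iSup_eq_range_dfinsupp_lsum]
    rfl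
  have hdim : Module.finrank K (DirectSum ι fun i => s i) = Module.finrank K M := by
    rw [Module.finrank_directSum, hsum]
  exact ⟨(LinearMap.injective_iff_surjective_of_finrank_eq_finrank hdim).mpr hsurj, hsurj⟩

namespace IsTwistedGroupAlgebra

theorem finiteDimensional (h : IsTwistedGroupAlgebra 𝒜) (g : G) : FiniteDimensional ℝ (𝒜 g) :=
  .of_finrank_pos (by rw [h.finrank_eq_one]; exact one_pos)

theorem ne_bot (h : IsTwistedGroupAlgebra 𝒜) (g : G) : 𝒜 g ≠ ⊥ := by
  have := h.finiteDimensional g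
  rw [← Submodule.one_le_finrank_iff, h.finrank_eq_one]

theorem eq_of_le (h : IsTwistedGroupAlgebra 𝒜) {g : G} {p : Submodule ℝ R} (hp : p ≠ ⊥)
    (hle : p ≤ 𝒜 g) : p = 𝒜 g := by
  have := h.finiteDimensional g
  have : FiniteDimensional ℝ p := Submodule.finiteDimensional_of_le hle
  refine Submodule.eq_of_le_of_finrank_le hle ?_
  rw [h.finrank_eq_one]
  exact Submodule.one_le_finrank_iff.mpr hp

theorem exists_smul_eq (h : IsTwistedGroupAlgebra 𝒜) {g : G} {x y : R} (hx : x ∈ 𝒜 g)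
    (hx0 : x ≠ 0) (hy : y ∈ 𝒜 g) : ∃ c : ℝ, c • x = y := by
  have hspan : Submodule.span ℝ {x} = 𝒜 g := h.eq_of_le (by simpa using hx0) (by simpa using hx)
  rwa [← Submodule.mem_span_singleton, hspan]

theorem exists_mem_ne_zero (h : IsTwistedGroupAlgebra 𝒜) (g : G) : ∃ x ∈ 𝒜 g, x ≠ 0 :=
  Submodule.exists_mem_ne_zero_of_ne_bot (h.ne_bot g)

theorem nontrivial (h : IsTwistedGroupAlgebra 𝒜) : Nontrivial R :=
  let ⟨x, _, hx0⟩ := h.exists_mem_ne_zero 0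
  nontrivial_of_ne x 0 hx0

omit [AddCommGroup H] in
theorem exists_tmul_eq (h : IsTwistedGroupAlgebra 𝒜) {p : G × H} {z : R ⊗[ℝ] S}
    (hz : z ∈ tensorGrading 𝒜 ℬ p) : ∃ x ∈ 𝒜 p.1, ∃ y ∈ ℬ p.2, z = x ⊗ₜ y := by
  obtain ⟨u, hu, hu0⟩ := h.exists_mem_ne_zero p.1
  suffices hz : z ∈ (ℬ p.2).map (TensorProduct.mk ℝ R S u) by
    obtain ⟨y, hy, rfl⟩ := hz
    exact ⟨u, hu, y, hy, rfl⟩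
  refine map_mem_of_mem_tensorGrading (f := .id) (fun x hx y hy => ?_) z hz
  obtain ⟨c, rfl⟩ := h.exists_smul_eq hu hu0 hx
  exact ⟨c • y, (ℬ p.2).smul_mem c hy, (TensorProduct.smul_tmul c u y).symm⟩

theorem isDivisionGrading_tensor [Finite H] [FiniteDimensional ℝ R]
    [FiniteDimensional ℝ S] (h𝒜 : IsTwistedGroupAlgebra 𝒜) (hℬ : IsDivisionGrading ℬ) :
    IsDivisionGrading (tensorGrading 𝒜 ℬ) := by
  have := h𝒜.finite h𝒜.ne_bot
  cases nonempty_fintype G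
  cases nonempty_fintype H
  refine
    { gradedMonoid :=
        { one_mem := tmul_mem_tensorGrading h𝒜.one_mem hℬ.one_mem
          mul_mem := fun p q z w hz hw => ?_ }
      isInternal := isInternal_of_iSup_eq_top_of_sum_finrank
        (iSup_tensorGrading_eq_top h𝒜.iSup_eq_top hℬ.iSup_eq_top) ?_
      isUnit := fun p z hz hz0 => ?_ }
  · obtain ⟨x, hx, y, hy, rfl⟩ := h𝒜.exists_tmul_eq hz
    obtain ⟨x', hx', y', hy', rfl⟩ := h𝒜.exists_tmul_eq hw
    rw [Algebra.TensorProduct.tmul_mul_tmul]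
    exact tmul_mem_tensorGrading (h𝒜.mul_mem hx hx') (hℬ.mul_mem hy hy')
  · simp only [finrank_tensorGrading, Module.finrank_tensorProduct, ← h𝒜.sum_finrank,
      ← hℬ.sum_finrank, Finset.sum_mul_sum, Fintype.sum_prod_type]
  · obtain ⟨x, hx, y, hy, rfl⟩ := h𝒜.exists_tmul_eq hz
    have hx1 := h𝒜.isUnit p.1 x hx (by rintro rfl; simp at hz0)
    have hy1 := hℬ.isUnit p.2 y hy (by rintro rfl; simp at hz0)
    simpa using (hx1.map (Algebra.TensorProduct.includeLeft (R := ℝ) (S := ℝ) (B := S))).mul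
      (hy1.map (Algebra.TensorProduct.includeRight (R := ℝ) (A := R)))

theorem finrank_tensorPowerGrading (h : IsTwistedGroupAlgebra 𝒜) (k : ℕ) (g : Fin k → G) :
    Module.finrank ℝ (tensorPowerGrading 𝒜 k g) = 1 := by
  induction k with
  | zero =>
    have := (WeaklyIsomorphic.tensor_tensorPower_zero 𝒜 𝒜).symm.finrank_eq h.finrank_eq_one (0, g)
    rwa [finrank_tensorGrading, h.finrank_eq_one, one_mul] at this
  | succ k ih =>
    refine (WeaklyIsomorphic.tensorPower_succ 𝒜 k).symm.finrank_eq (fun p => ?_) g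
    rw [finrank_tensorGrading, ih, h.finrank_eq_one]

theorem isDivisionGrading_tensor_tensorPower [Finite H] [FiniteDimensional ℝ R]
    [FiniteDimensional ℝ S] (h𝒜 : IsTwistedGroupAlgebra 𝒜) (hℬ : IsDivisionGrading ℬ) (k : ℕ) :
    IsDivisionGrading (tensorGrading (tensorPowerGrading 𝒜 k) ℬ) := by
  have := h𝒜.finite h𝒜.ne_bot
  induction k with
  | zero =>
    exact ((WeaklyIsomorphic.tensor_comm _ _).trans
      (WeaklyIsomorphic.tensor_tensorPower_zero 𝒜 ℬ)).symm.isDivisionGrading hℬ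
  | succ k ih =>
    have hcomm := (WeaklyIsomorphic.tensorPower_succ 𝒜 k).trans (.tensor_comm _ _)
    exact ((hcomm.tensor (.refl ℬ)).trans
      (.tensor_assoc _ _ _)).symm.isDivisionGrading (h𝒜.isDivisionGrading_tensor ih)

end IsTwistedGroupAlgebra

end TwistedGroupAlgebras

section QuaternionSplitting

variable {K R : Type*} [Field K] [Ring R] [Algebra K R] {c₁ c₂ : K}

/-- The sum of the conjugates of `x` by `1`, `i`, `j` and `k`. Since conjugation by one of these
permutes the summands, this is an element of the centralizer of `i` and `j`. -/
noncomputable def sumConj (q : QuaternionAlgebra.Basis R c₁ 0 c₂) : R →ₗ[K] R :=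
  LinearMap.id + c₁⁻¹ • LinearMap.mulLeftRight K (q.i, q.i) +
    c₂⁻¹ • LinearMap.mulLeftRight K (q.j, q.j) - (c₁ * c₂)⁻¹ • LinearMap.mulLeftRight K (q.k, q.k)

theorem sumConj_apply (q : QuaternionAlgebra.Basis R c₁ 0 c₂) (x : R) :
    sumConj q x =
      x + c₁⁻¹ • (q.i * x * q.i) + c₂⁻¹ • (q.j * x * q.j) - (c₁ * c₂)⁻¹ • (q.k * x * q.k) := by
  simp [sumConj]

theorem sumConj_mul_of_commute (q : QuaternionAlgebra.Basis R c₁ 0 c₂) {c : R}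
    (hi : Commute c q.i) (hj : Commute c q.j) (x : R) : sumConj q (c * x) = c * sumConj q x := by
  have hk : Commute c q.k := q.i_mul_j ▸ hi.mul_right hj
  simp only [sumConj_apply, mul_add, mul_sub, mul_smul_comm, ← mul_assoc, hi.eq, hj.eq, hk.eq]

theorem sumConj_lift (q : QuaternionAlgebra.Basis R c₁ 0 c₂) (h₁ : c₁ ≠ 0) (h₂ : c₂ ≠ 0)
    (x : ℍ[K,c₁,0,c₂]) : sumConj q (q.lift x) = (4 * x.re) • 1 := by
  simp only [sumConj_apply, QuaternionAlgebra.Basis.lift, Algebra.algebraMap_eq_smul_one, mul_add,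
    add_mul, mul_smul_comm, smul_mul_assoc, mul_one, one_mul, q.i_mul_i, q.j_mul_j, q.i_mul_j,
    q.j_mul_i, q.i_mul_k, q.k_mul_i, q.k_mul_j, q.j_mul_k, q.k_mul_k, sub_mul, neg_mul]
  match_scalars <;> field_simp <;> ring

theorem sumConj_mem_centralizer (q : QuaternionAlgebra.Basis R c₁ 0 c₂) (h₁ : c₁ ≠ 0)
    (h₂ : c₂ ≠ 0) (x : R) :
    sumConj q x ∈ Subalgebra.centralizer K {q.i, q.j} := by
  have hi : Commute q.i (sumConj q x) := by
    have hii (y : R) : q.i * (q.i * y) = c₁ • y := by simp [← mul_assoc]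
    have hij (y : R) : q.i * (q.j * y) = q.k * y := by simp [← mul_assoc]
    have hik (y : R) : q.i * (q.k * y) = c₁ • (q.j * y) := by simp [← mul_assoc]
    simp only [commute_iff_eq, sumConj_apply, mul_add, mul_sub, add_mul, sub_mul, mul_smul_comm,
      smul_mul_assoc, mul_assoc, hii, hij, hik, q.i_mul_i, q.j_mul_i, q.k_mul_i, mul_one]
    match_scalars <;> field_simp <;> ring
  have hj : Commute q.j (sumConj q x) := by
    have hjj (y : R) : q.j * (q.j * y) = c₂ • y := by simp [← mul_assoc]
    have hji (y : R) : q.j * (q.i * y) = -(q.k * y) := by simp [← mul_assoc]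
    have hjk (y : R) : q.j * (q.k * y) = -c₂ • (q.i * y) := by simp [← mul_assoc]
    simp only [commute_iff_eq, sumConj_apply, mul_add, mul_sub, add_mul, sub_mul, mul_smul_comm,
      smul_mul_assoc, mul_assoc, hjj, hji, hjk, q.i_mul_j, q.j_mul_j, q.k_mul_j, mul_one]
    match_scalars <;> field_simp
  rw [Subalgebra.mem_centralizer_iff]
  rintro _ (rfl | rfl)
  exacts [hi, hj]

theorem sumConj_expansion (q : QuaternionAlgebra.Basis R c₁ 0 c₂) (h₁ : c₁ ≠ 0) (h₂ : c₂ ≠ 0)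
    (x : R) :
    sumConj q x + c₁⁻¹ • (sumConj q (x * q.i) * q.i) + c₂⁻¹ • (sumConj q (x * q.j) * q.j) -
      (c₁ * c₂)⁻¹ • (sumConj q (x * q.k) * q.k) = (4 : K) • x := by
  simp only [sumConj_apply, add_mul, sub_mul, mul_assoc, smul_mul_assoc, mul_smul_comm, mul_one,
    mul_add, mul_sub, mul_neg, neg_mul, q.i_mul_i, q.j_mul_j, q.i_mul_j, q.j_mul_i, q.i_mul_k,
    q.k_mul_i, q.k_mul_j, q.j_mul_k, q.k_mul_k]
  match_scalars <;> field_simp <;> ring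

theorem commute_of_mem_centralizer {q : QuaternionAlgebra.Basis R c₁ 0 c₂} {c : R}
    (hc : c ∈ Subalgebra.centralizer K {q.i, q.j}) :
    Commute c q.i ∧ Commute c q.j ∧ Commute c q.k := by
  rw [Subalgebra.mem_centralizer_iff] at hc
  have hi : Commute c q.i := (hc q.i (by simp)).symm
  have hj : Commute c q.j := (hc q.j (by simp)).symm
  exact ⟨hi, hj, q.i_mul_j ▸ hi.mul_right hj⟩

theorem commute_lift_of_mem_centralizer {q : QuaternionAlgebra.Basis R c₁ 0 c₂} {c : R}
    (hc : c ∈ Subalgebra.centralizer K {q.i, q.j}) (x : ℍ[K,c₁,0,c₂]) : Commute c (q.lift x) := by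
  obtain ⟨hi, hj, hk⟩ := commute_of_mem_centralizer hc
  exact (((Algebra.commute_algebraMap_right _ _).add_right (hi.smul_right _)).add_right
    (hj.smul_right _)).add_right (hk.smul_right _)

theorem sumConj_mul_lift (q : QuaternionAlgebra.Basis R c₁ 0 c₂) (h₁ : c₁ ≠ 0) (h₂ : c₂ ≠ 0)
    (c : Subalgebra.centralizer K {q.i, q.j}) (x : ℍ[K,c₁,0,c₂]) :
    sumConj q (c * q.lift x) = (4 * x.re) • (c : R) := by
  obtain ⟨hi, hj, -⟩ := commute_of_mem_centralizer c.2
  rw [sumConj_mul_of_commute q hi hj, sumConj_lift q h₁ h₂, mul_smul_one]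

/-- Multiplication, as a homomorphism from the tensor product of the centralizer of `i` and `j`
with the quaternion algebra to `R`. -/
noncomputable def centralizerTensorHom (q : QuaternionAlgebra.Basis R c₁ 0 c₂) :
    Subalgebra.centralizer K {q.i, q.j} ⊗[K] ℍ[K,c₁,0,c₂] →ₐ[K] R :=
  Algebra.TensorProduct.lift (Subalgebra.centralizer K {q.i, q.j}).val q.liftHom
    fun c x => commute_lift_of_mem_centralizer c.2 x

theorem centralizerTensorHom_tmul (q : QuaternionAlgebra.Basis R c₁ 0 c₂)
    (c : Subalgebra.centralizer K {q.i, q.j}) (x : ℍ[K,c₁,0,c₂]) :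
    centralizerTensorHom q (c ⊗ₜ x) = c * q.lift x :=
  rfl

theorem exists_sum_tmul_quaternionAlgebra_eq {C : Type*} [Ring C] [Algebra K C]
    (z : C ⊗[K] ℍ[K,c₁,0,c₂]) :
    ∃ a b c d : C, z = a ⊗ₜ ⟨1, 0, 0, 0⟩ + b ⊗ₜ ⟨0, 1, 0, 0⟩ + c ⊗ₜ ⟨0, 0, 1, 0⟩ +
      d ⊗ₜ ⟨0, 0, 0, 1⟩ := by
  induction z with
  | zero => exact ⟨0, 0, 0, 0, by simp⟩
  | tmul a x =>
    refine ⟨x.re • a, x.imI • a, x.imJ • a, x.imK • a, ?_⟩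
    simp only [TensorProduct.smul_tmul, ← TensorProduct.tmul_add]
    congr 1
    ext <;> simp
  | add z w hz hw =>
    obtain ⟨a, b, c, d, rfl⟩ := hz
    obtain ⟨a', b', c', d', rfl⟩ := hw
    refine ⟨a + a', b + b', c + c', d + d', ?_⟩
    simp only [TensorProduct.add_tmul]
    abel

variable [NeZero (2 : K)]

theorem centralizerTensorHom_bijective (q : QuaternionAlgebra.Basis R c₁ 0 c₂) (h₁ : c₁ ≠ 0)
    (h₂ : c₂ ≠ 0) : Function.Bijective (centralizerTensorHom q) := by
  have h2 : (2 : K) ≠ 0 := NeZero.ne 2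
  have h4 : (4 : K) ≠ 0 := by
    rw [show (4 : K) = 2 * 2 by norm_num]
    exact mul_ne_zero h2 h2
  constructor
  · rw [injective_iff_map_eq_zero]
    intro z hz
    obtain ⟨a, b, c, d, rfl⟩ := exists_sum_tmul_quaternionAlgebra_eq z
    have hcoeff (x : ℍ[K,c₁,0,c₂]) : (4 * x.re) • a + (4 * (c₁ * x.imI)) • b +
        (4 * (c₂ * x.imJ)) • c + (-(4 * (c₁ * c₂ * x.imK))) • d = 0 := by
      have := congrArg (fun w => sumConj q (w * q.lift x)) hz
      refine Subtype.ext ?_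
      simpa [centralizerTensorHom_tmul, add_mul, mul_assoc, ← q.lift_mul, sumConj_mul_lift, h₁, h₂]
        using this
    obtain rfl : a = 0 := by simpa [h4] using hcoeff ⟨1, 0, 0, 0⟩
    obtain rfl : b = 0 := by simpa [h4, h₁] using hcoeff ⟨0, 1, 0, 0⟩
    obtain rfl : c = 0 := by simpa [h4, h₂] using hcoeff ⟨0, 0, 1, 0⟩
    obtain rfl : d = 0 := by simpa [h4, h₁, h₂] using hcoeff ⟨0, 0, 0, 1⟩
    simp
  · intro x
    let P (y : R) : Subalgebra.centralizer K {q.i, q.j} :=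
      ⟨sumConj q y, sumConj_mem_centralizer q h₁ h₂ y⟩
    refine ⟨(4 : K)⁻¹ • (P x ⊗ₜ 1 + c₁⁻¹ • P (x * q.i) ⊗ₜ ⟨0, 1, 0, 0⟩ +
      c₂⁻¹ • P (x * q.j) ⊗ₜ ⟨0, 0, 1, 0⟩ - (c₁ * c₂)⁻¹ • P (x * q.k) ⊗ₜ ⟨0, 0, 0, 1⟩), ?_⟩
    rw [map_smul, inv_smul_eq_iff₀ h4, ← sumConj_expansion q h₁ h₂ x]
    simp [centralizerTensorHom_tmul, P, QuaternionAlgebra.Basis.lift]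

theorem mem_center_centralizer_iff (q : QuaternionAlgebra.Basis R c₁ 0 c₂) (h₁ : c₁ ≠ 0)
    (h₂ : c₂ ≠ 0) {c : Subalgebra.centralizer K {q.i, q.j}} :
    c ∈ Subalgebra.center K (Subalgebra.centralizer K {q.i, q.j}) ↔
      (c : R) ∈ Subalgebra.center K R := by
  simp only [Subalgebra.mem_center_iff]
  refine ⟨fun hc => ?_, fun hc d => Subtype.ext (hc d)⟩
  have hcomm (z) : Commute (centralizerTensorHom q z) (c : R) := by
    induction z with
    | zero => simp
    | tmul d x =>
      rw [centralizerTensorHom_tmul]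
      exact .mul_left (congrArg Subtype.val (hc d)) (commute_lift_of_mem_centralizer c.2 x).symm
    | add z w hz hw => rw [map_add]; exact hz.add_left hw
  intro x
  obtain ⟨z, rfl⟩ := (centralizerTensorHom_bijective q h₁ h₂).surjective x
  exact hcomm z

end QuaternionSplitting

section CentralizerGradings

theorem isUnit_centralizer {F R : Type*} [CommRing F] [Ring R] [Algebra F R] {s : Set R}
    {c : Subalgebra.centralizer F s} (hc : IsUnit (c : R)) : IsUnit c := by
  obtain ⟨u, hu⟩ := hc
  have hmem : (↑u⁻¹ : R) ∈ Subalgebra.centralizer F s := by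
    rw [Subalgebra.mem_centralizer_iff]
    intro y hy
    have huy : Commute y u := by
      rw [hu]
      exact (Subalgebra.mem_centralizer_iff F).mp c.2 y hy
    exact huy.units_inv_right
  exact ⟨⟨c, ⟨_, hmem⟩, Subtype.ext (by simp [← hu]), Subtype.ext (by simp [← hu])⟩, rfl⟩

variable {G H K R : Type*} [AddCommGroup G] [AddCommGroup H] [AddCommGroup K] [Ring R] [Algebra ℝ R]
  {𝒜 : G → Submodule ℝ R}

theorem IsDivisionGrading.exists_sum_eq_forall_commute (h : IsDivisionGrading 𝒜) (x : R) :
    ∃ (s : Finset G) (v : G → R), (∀ g, v g ∈ 𝒜 g) ∧ ∑ g ∈ s, v g = x ∧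
      ∀ g', ∀ y ∈ 𝒜 g', Commute x y → ∀ g, Commute (v g) y := by
  classical
  have hint : DirectSum.IsInternal 𝒜 := by convert h.isInternal
  let : GradedRing 𝒜 := { h.gradedMonoid, hint.chooseDecomposition with }
  refine ⟨(DirectSum.decompose 𝒜 x).support, fun g => DirectSum.decompose 𝒜 x g,
    fun g => (DirectSum.decompose 𝒜 x g).2, DirectSum.sum_support_decompose 𝒜 x,
    fun g' y hy hxy g => ?_⟩
  rw [commute_iff_eq, ← DirectSum.coe_decompose_mul_add_of_right_mem 𝒜 hy, hxy.eq, add_comm g g',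
    DirectSum.coe_decompose_mul_add_of_left_mem 𝒜 hy]

/-- The grading which the centralizer of `s` inherits from a grading of the whole algebra. The
degrees are pulled back along a homomorphism `ι`, so that the grading group can be shrunk to the
support of the centralizer. -/
def centralizerGrading (𝒜 : G → Submodule ℝ R) (s : Set R) (ι : K →+ G) :
    K → Submodule ℝ (Subalgebra.centralizer ℝ s) :=
  fun a => (𝒜 (ι a)).comap (Subalgebra.centralizer ℝ s).val.toLinearMap

theorem mem_centralizerGrading {s : Set R} {ι : K →+ G} {a : K} {c : Subalgebra.centralizer ℝ s} :
    c ∈ centralizerGrading 𝒜 s ι a ↔ (c : R) ∈ 𝒜 (ι a) :=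
  Iff.rfl

namespace IsDivisionGrading

theorem iSup_centralizerGrading (h : IsDivisionGrading 𝒜) {s : Set R}
    (hs : ∀ y ∈ s, ∃ g, y ∈ 𝒜 g) {ι : K →+ G}
    (hsupp : ∀ g, ∀ x ∈ 𝒜 g, x ≠ 0 → x ∈ Subalgebra.centralizer ℝ s → g ∈ ι.range) :
    ⨆ a, centralizerGrading 𝒜 s ι a = ⊤ := by
  refine eq_top_iff.mpr fun c _ => ?_
  obtain ⟨t, v, hv, hsum, hcomm⟩ := h.exists_sum_eq_forall_commute (c : R)
  have hvC (g : G) : v g ∈ Subalgebra.centralizer ℝ s := by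
    rw [Subalgebra.mem_centralizer_iff]
    intro y hy
    obtain ⟨g', hg'⟩ := hs y hy
    exact (hcomm g' y hg' ((Subalgebra.mem_centralizer_iff ℝ).mp c.2 y hy).symm g).symm
  have hc : c = ∑ g ∈ t, ⟨v g, hvC g⟩ := Subtype.ext (by simp [hsum])
  rw [hc]
  refine sum_mem fun g _ => ?_
  obtain hv0 | hv0 := eq_or_ne (v g) 0
  · have : (⟨v g, hvC g⟩ : Subalgebra.centralizer ℝ s) = 0 := Subtype.ext hv0
    exact this ▸ zero_mem _
  · obtain ⟨a, rfl⟩ := hsupp g _ (hv g) hv0 (hvC g)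
    exact Submodule.mem_iSup_of_mem a (hv (ι a))

theorem centralizer (h : IsDivisionGrading 𝒜) {s : Set R} {ι : K →+ G}
    (hι : Function.Injective ι) (htop : ⨆ a, centralizerGrading 𝒜 s ι a = ⊤) :
    IsDivisionGrading (centralizerGrading 𝒜 s ι) where
  gradedMonoid :=
    { one_mem := by simpa [mem_centralizerGrading] using h.one_mem
      mul_mem := fun a b x y hx hy => by
        simpa [mem_centralizerGrading] using h.mul_mem hx hy }
  isInternal := by
    classical
    refine DirectSum.isInternal_submodule_of_iSupIndep_of_iSup_eq_top ?_ htop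
    exact iSupIndep_of_injective_of_mapsTo
      (Subalgebra.centralizer ℝ s).val.toLinearMap Subtype.val_injective
      (fun _ _ hx => hx) (h.iSupIndep.comp hι)
  isUnit := fun a x hx hx0 => isUnit_centralizer (h.isUnit (ι a) x hx (by simpa using hx0))

theorem weaklyIsomorphic_centralizer_tensor (h : IsDivisionGrading 𝒜) {c₁ c₂ : ℝ}
    {q : QuaternionAlgebra.Basis R c₁ 0 c₂} (h₁ : c₁ ≠ 0) (h₂ : c₂ ≠ 0) {ι : K →+ G}
    (htop : ⨆ a, centralizerGrading 𝒜 {q.i, q.j} ι a = ⊤) {B : Type*} [Ring B] [Algebra ℝ B]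
    {ℬ : H → Submodule ℝ B} (hℬ : ⨆ b, ℬ b = ⊤) (e : B ≃ₐ[ℝ] ℍ[ℝ,c₁,0,c₂]) {β : H →+ G}
    (hβ : ∀ b, ∀ x ∈ ℬ b, q.lift (e x) ∈ 𝒜 (β b)) (hbij : Function.Bijective (ι.coprod β)) :
    WeaklyIsomorphic (tensorGrading (centralizerGrading 𝒜 {q.i, q.j} ι) ℬ) 𝒜 := by
  let φ := (Algebra.TensorProduct.congr (.refl : _ ≃ₐ[ℝ] Subalgebra.centralizer ℝ {q.i, q.j})
    e).trans (AlgEquiv.ofBijective _ (centralizerTensorHom_bijective q h₁ h₂))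
  exact .of_iSup_eq_top φ (.ofBijective _ hbij)
    (fun p => map_mem_of_mem_tensorGrading (f := φ.toLinearMap) fun c hc x hx =>
      h.mul_mem hc (hβ p.2 x hx))
    (iSup_tensorGrading_eq_top htop hℬ) h.iSupIndep

end IsDivisionGrading

end CentralizerGradings

section CommutationForms

theorem neg_one_uzpow_smul_injective {M : Type*} [AddCommGroup M] [Module ℝ M] {z : M}
    (hz : z ≠ 0) : Function.Injective fun k : ZMod 2 => (-1 : ℤˣ) ^ k • z := by
  have hneg : z ≠ -z := fun h => hz <| by
    have : (2 : ℝ) • z = 0 := by rw [two_smul, ← eq_neg_iff_add_eq_zero, ← h]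
    simpa using this
  have hzmod (k : ZMod 2) : k = 0 ∨ k = 1 := by decide +revert
  intro k l hkl
  obtain rfl | rfl := hzmod k <;> obtain rfl | rfl := hzmod l <;> simp_all

variable {G R : Type*} [AddCommGroup G] [Ring R] [Algebra ℝ R] {𝒜 : G → Submodule ℝ R}

/-- The bilinear form `b` on the grading group records, additively in `ZMod 2`, by which sign two
homogeneous elements commute. -/
def IsCommutationForm (𝒜 : G → Submodule ℝ R) (b : G →+ G →+ ZMod 2) : Prop :=
  ∀ g g', ∀ x ∈ 𝒜 g, ∀ y ∈ 𝒜 g', x * y = (-1 : ℤˣ) ^ b g g' • (y * x)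

namespace IsTwistedGroupAlgebra

theorem pow_card_commute (h : IsTwistedGroupAlgebra 𝒜) {g : G} {x : R} (hx : x ∈ 𝒜 g)
    (y : R) : Commute (x ^ Nat.card G) y := by
  have := h.nontrivial
  have hmem := h.pow_mem hx (Nat.card G)
  rw [card_nsmul_eq_zero'] at hmem
  obtain ⟨r, hr⟩ := h.exists_smul_eq h.one_mem one_ne_zero hmem
  rw [← hr]
  exact (Commute.one_left y).smul_left r

theorem exists_sign_of_ne_zero [Finite G] (h : IsTwistedGroupAlgebra 𝒜) {g g' : G} {x y : R}
    (hx : x ∈ 𝒜 g) (hx0 : x ≠ 0) (hy : y ∈ 𝒜 g') (hy0 : y ≠ 0) :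
    ∃ k : ZMod 2, x * y = (-1 : ℤˣ) ^ k • (y * x) := by
  have := h.nontrivial
  have hxu := h.isUnit g x hx hx0
  have hyu := h.isUnit g' y hy hy0
  obtain ⟨c, hc⟩ := h.exists_smul_eq (h.mul_mem hy hx) (hyu.mul hxu).ne_zero
    (add_comm g g' ▸ h.mul_mem hx hy)
  have hpow (n : ℕ) : x ^ n * y = c ^ n • (y * x ^ n) := by
    induction n with
    | zero => simp
    | succ n ih =>
      rw [pow_succ, mul_assoc, ← hc, mul_smul_comm, ← mul_assoc, ih, smul_mul_assoc, smul_smul,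
        pow_succ', mul_assoc]
  have hcn : c ^ Nat.card G = 1 := by
    have hne := (hyu.mul (hxu.pow (Nat.card G))).ne_zero
    refine smul_left_injective ℝ hne ?_
    simp only [← hpow, one_smul, (h.pow_card_commute hx y).eq]
  obtain rfl | rfl : c = 1 ∨ c = -1 := by
    have : |c| = 1 := (pow_eq_one_iff_of_nonneg (abs_nonneg c) Nat.card_pos.ne').mp
      (by rw [← abs_pow, hcn, abs_one])
    exact eq_or_eq_neg_of_abs_eq this
  · exact ⟨0, by simp [← hc]⟩
  · exact ⟨1, by simp [← hc]⟩

theorem exists_sign [Finite G] (h : IsTwistedGroupAlgebra 𝒜) (g g' : G) :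
    ∃ k : ZMod 2, ∀ x ∈ 𝒜 g, ∀ y ∈ 𝒜 g', x * y = (-1 : ℤˣ) ^ k • (y * x) := by
  obtain ⟨u, hu, hu0⟩ := h.exists_mem_ne_zero g
  obtain ⟨v, hv, hv0⟩ := h.exists_mem_ne_zero g'
  obtain ⟨k, hk⟩ := h.exists_sign_of_ne_zero hu hu0 hv hv0
  refine ⟨k, fun x hx y hy => ?_⟩
  obtain ⟨c, rfl⟩ := h.exists_smul_eq hu hu0 hx
  obtain ⟨d, rfl⟩ := h.exists_smul_eq hv hv0 hy
  rw [smul_mul_smul_comm, hk, smul_mul_smul_comm, mul_comm d c, smul_comm]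

theorem exists_commutationForm [Finite G] (h : IsTwistedGroupAlgebra 𝒜) :
    ∃ b : G →+ G →+ ZMod 2, IsCommutationForm 𝒜 b := by
  choose b hb using h.exists_sign
  choose u hu hu0 using h.exists_mem_ne_zero
  have := h.nontrivial
  have hunit (g : G) : IsUnit (u g) := h.isUnit g _ (hu g) (hu0 g)
  have hleft (g₁ g₂ g' : G) : b (g₁ + g₂) g' = b g₁ g' + b g₂ g' := by
    refine neg_one_uzpow_smul_injective
      ((hunit g').mul ((hunit g₁).mul (hunit g₂))).ne_zero ?_
    simp only
    rw [← hb _ _ _ (h.mul_mem (hu g₁) (hu g₂)) _ (hu g'), mul_assoc, hb _ _ _ (hu g₂) _ (hu g'),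
      mul_smul_comm, ← mul_assoc, hb _ _ _ (hu g₁) _ (hu g'), smul_mul_assoc, smul_smul, mul_assoc,
      ← uzpow_add, add_comm]
  have hright (g g₁ g₂ : G) : b g (g₁ + g₂) = b g g₁ + b g g₂ := by
    refine neg_one_uzpow_smul_injective
      (((hunit g₁).mul (hunit g₂)).mul (hunit g)).ne_zero ?_
    simp only
    rw [← hb _ _ _ (hu g) _ (h.mul_mem (hu g₁) (hu g₂)), ← mul_assoc, hb _ _ _ (hu g) _ (hu g₁),
      smul_mul_assoc, mul_assoc, hb _ _ _ (hu g) _ (hu g₂), mul_smul_comm, smul_smul, mul_assoc,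
      ← uzpow_add]
  exact ⟨AddMonoidHom.mk' (fun g => AddMonoidHom.mk' (b g) (hright g))
    fun g₁ g₂ => AddMonoidHom.ext (hleft g₁ g₂), hb⟩

end IsTwistedGroupAlgebra

namespace IsCommutationForm

variable {b : G →+ G →+ ZMod 2} {g g' : G} {x y : R}

theorem mul_eq_neg_mul (hb : IsCommutationForm 𝒜 b) (hx : x ∈ 𝒜 g) (hy : y ∈ 𝒜 g')
    (hgg' : b g g' = 1) : x * y = -(y * x) := by
  simpa [hgg'] using hb g g' x hx y hy

theorem commute (hb : IsCommutationForm 𝒜 b) (hx : x ∈ 𝒜 g) (hy : y ∈ 𝒜 g')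
    (hgg' : b g g' = 0) : Commute x y := by
  simpa [hgg', commute_iff_eq] using hb g g' x hx y hy

theorem eq_zero_of_commute (hb : IsCommutationForm 𝒜 b) (h : IsDivisionGrading 𝒜) (hx : x ∈ 𝒜 g)
    (hx0 : x ≠ 0) (hy : y ∈ 𝒜 g') (hy0 : y ≠ 0) (hxy : Commute x y) : b g g' = 0 := by
  have : Nontrivial R := nontrivial_of_ne x 0 hx0
  refine neg_one_uzpow_smul_injective ((h.isUnit g' y hy hy0).mul (h.isUnit g x hx hx0)).ne_zero ?_
  simp only [← hb g g' x hx y hy, uzpow_zero, one_smul, hxy.eq]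

theorem apply_self (hb : IsCommutationForm 𝒜 b) (h : IsTwistedGroupAlgebra 𝒜) (g : G) :
    b g g = 0 := by
  obtain ⟨x, hx, hx0⟩ := h.exists_mem_ne_zero g
  exact hb.eq_zero_of_commute h.toIsDivisionGrading hx hx0 hx hx0 (.refl x)

theorem symm (hb : IsCommutationForm 𝒜 b) (h : IsTwistedGroupAlgebra 𝒜) (g g' : G) :
    b g g' = b g' g := by
  have := hb.apply_self h (g + g')
  simp only [map_add, AddMonoidHom.add_apply, hb.apply_self h, zero_add, add_zero] at this
  exact (CharTwo.add_eq_zero.mp this).symm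

end IsCommutationForm

end CommutationForms

section CentralImaginaryUnits

variable {G S : Type*} [AddCommGroup G] [Ring S] [Algebra ℝ S] {𝒜 : G → Submodule ℝ S}

theorem IsDivisionGrading.mem_center (h : IsDivisionGrading 𝒜) {x : S}
    (hx : ∀ g, ∀ y ∈ 𝒜 g, Commute x y) : x ∈ Subalgebra.center ℝ S := by
  refine Subalgebra.mem_center_iff.mpr fun y => ?_
  have hy : y ∈ ⨆ g, 𝒜 g := h.iSup_eq_top ▸ Submodule.mem_top
  induction hy using Submodule.iSup_induction' with
  | mem g y hy => exact (hx g y hy).symm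
  | zero => rw [mul_zero, zero_mul]
  | add y z _ _ hy hz => rw [add_mul, mul_add, hy, hz]

/-- `J` is an imaginary unit spanning the center together with `1`: a way of saying that the center
of the real algebra `S` is a copy of `ℂ`, without a second scalar action on `S`. -/
structure IsCentralImaginaryUnit (J : S) : Prop where
  mul_self : J * J = -1
  mem_center_iff : ∀ {x}, x ∈ Subalgebra.center ℝ S ↔ ∃ p q : ℝ, x = p • 1 + q • J

namespace IsCentralImaginaryUnit

variable {J : S} (hJ : IsCentralImaginaryUnit J)
include hJ

theorem commute (x : S) : Commute J x :=
  (Subalgebra.mem_center_iff.mp (hJ.mem_center_iff.mpr ⟨0, 1, by simp⟩) x).symm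

theorem centralizer {c₁ c₂ : ℝ} (q : QuaternionAlgebra.Basis S c₁ 0 c₂) (h₁ : c₁ ≠ 0)
    (h₂ : c₂ ≠ 0) :
    IsCentralImaginaryUnit (⟨J, Subalgebra.center_le_centralizer ℝ _
      (hJ.mem_center_iff.mpr ⟨0, 1, by simp⟩)⟩ : Subalgebra.centralizer ℝ {q.i, q.j}) where
  mul_self := Subtype.ext hJ.mul_self
  mem_center_iff := by
    simp [mem_center_centralizer_iff q h₁ h₂, hJ.mem_center_iff, Subtype.ext_iff]

theorem ne_zero [Nontrivial S] : J ≠ 0 := by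
  rintro rfl
  simpa using hJ.mul_self

theorem notMem_zero (h : IsTwistedGroupAlgebra 𝒜) : J ∉ 𝒜 0 := by
  intro hmem
  have := h.nontrivial
  obtain ⟨r, rfl⟩ := h.exists_smul_eq h.one_mem one_ne_zero hmem
  have hsq : (r * r + 1) • (1 : S) = 0 := by
    rw [add_smul, one_smul, ← eq_neg_iff_add_eq_zero, ← hJ.mul_self, smul_mul_smul_comm, mul_one]
  obtain hr | h1 := smul_eq_zero.mp hsq
  · nlinarith [mul_self_nonneg r]
  · exact one_ne_zero h1

theorem mem_of_mem_center (h : IsDivisionGrading 𝒜) {x : S} {g : G} (hg : g ≠ 0) (hx : x ∈ 𝒜 g)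
    (hx0 : x ≠ 0) (hcenter : x ∈ Subalgebra.center ℝ S) : J ∈ 𝒜 g := by
  obtain ⟨p, q, hpq⟩ := hJ.mem_center_iff.mp hcenter
  have hsq : (2 * p) • x = x * x + (p * p + q * q) • 1 := by
    simp only [hpq, add_mul, mul_add, smul_mul_smul_comm, mul_one, one_mul, hJ.mul_self]
    module
  have hp : p = 0 := by
    have : (2 * p) • x = 0 :=
      h.eq_zero_of_eq_add ((𝒜 g).smul_mem _ hx) (h.mul_mem hx hx) ((𝒜 0).smul_mem _ h.one_mem)
        (by simpa using hg) hg.symm hsq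
    simpa [hx0] using this
  rw [hp, zero_smul, zero_add] at hpq
  rw [hpq] at hx hx0
  exact ((𝒜 g).smul_mem_iff (left_ne_zero_of_smul hx0)).mp hx

theorem exists_mem (h : IsTwistedGroupAlgebra 𝒜) : ∃ e, J ∈ 𝒜 e := by
  obtain ⟨s, v, hv, hsum, hcomm⟩ := h.toIsDivisionGrading.exists_sum_eq_forall_commute J
  obtain ⟨g, hg⟩ : ∃ g, v g ∉ 𝒜 0 := by
    by_contra! hv0
    exact hJ.notMem_zero h (hsum ▸ sum_mem fun g _ => hv0 g)
  have hg0 : g ≠ 0 := by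
    rintro rfl
    exact hg (hv 0)
  have hvg : v g ≠ 0 := fun h0 => hg (h0 ▸ zero_mem _)
  exact ⟨g, hJ.mem_of_mem_center h.toIsDivisionGrading hg0 (hv g) hvg
    (h.mem_center fun g' y hy => hcomm g' y hy (hJ.commute y) g)⟩

variable (h : IsTwistedGroupAlgebra 𝒜) {e : G} (he : J ∈ 𝒜 e)
include h he

theorem degree_ne_zero : e ≠ 0 := by
  rintro rfl
  exact hJ.notMem_zero h he

theorem degree_add_degree : e + e = 0 :=
  have := h.nontrivial
  h.degree_eq (h.mul_mem he he) (hJ.mul_self ▸ (𝒜 0).neg_mem h.one_mem)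
    (hJ.mul_self ▸ neg_ne_zero.mpr one_ne_zero)

theorem commutationForm_eq_zero_iff {b : G →+ G →+ ZMod 2} (hb : IsCommutationForm 𝒜 b) {g : G} :
    b g = 0 ↔ g = 0 ∨ g = e := by
  have := h.nontrivial
  obtain ⟨x, hx, hx0⟩ := h.exists_mem_ne_zero g
  constructor
  · refine fun hg => or_iff_not_imp_left.mpr fun hg0 => ?_
    have hcenter := h.mem_center fun g' y hy => hb.commute hx hy (DFunLike.congr_fun hg g')
    exact h.degree_eq (hJ.mem_of_mem_center h.toIsDivisionGrading hg0 hx hx0 hcenter) he hJ.ne_zero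
  · rintro (rfl | rfl)
    · exact map_zero b
    · refine AddMonoidHom.ext fun g' => ?_
      obtain ⟨y, hy, hy0⟩ := h.exists_mem_ne_zero g'
      exact hb.eq_zero_of_commute h.toIsDivisionGrading he hJ.ne_zero hy hy0 (hJ.commute y)

theorem exists_mul_self_eq {b : G →+ G →+ ZMod 2} (hb : IsCommutationForm 𝒜 b) {g : G} {w : S}
    (hw : w ∈ 𝒜 (g + g)) : ∃ g', g' + g' = g + g ∧ b g' = b g ∧ ∃ x ∈ 𝒜 g', x * x = w := by
  have := h.nontrivial
  obtain ⟨u, hu, hu0⟩ := h.exists_mem_ne_zero g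
  have huu := ((h.isUnit g u hu hu0).mul (h.isUnit g u hu hu0)).ne_zero
  obtain ⟨c, rfl⟩ := h.exists_smul_eq (h.mul_mem hu hu) huu hw
  obtain hc | hc := le_total 0 c
  · refine ⟨g, rfl, rfl, √c • u, (𝒜 g).smul_mem _ hu, ?_⟩
    rw [smul_mul_smul_comm, Real.mul_self_sqrt hc]
  · have hbe : b e = 0 := (hJ.commutationForm_eq_zero_iff h he hb).mpr (.inr rfl)
    refine ⟨g + e, ?_, ?_, √(-c) • (u * J), (𝒜 (g + e)).smul_mem _ (h.mul_mem hu he), ?_⟩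
    · rw [add_add_add_comm, hJ.degree_add_degree h he, add_zero]
    · rw [map_add, hbe, add_zero]
    · rw [smul_mul_smul_comm, Real.mul_self_sqrt (neg_nonneg.mpr hc),
        (hJ.commute u).mul_mul_mul_comm, hJ.mul_self]
      simp

end IsCentralImaginaryUnit

end CentralImaginaryUnits

section Models

theorem isTwistedGroupAlgebra_gradingCtwo : IsTwistedGroupAlgebra gradingCtwo := by
  have hval (a : ZMod 2) : a.val = 0 ∨ a.val = 1 := by revert a; decide
  refine isTwistedGroupAlgebra_span_singleton (fun g => ?_) (by simp) (fun g g' => ?_) ?_ (by simp)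
  · exact (isUnit_iff_ne_zero.mpr Complex.I_ne_zero).pow _
  · refine ⟨(-1) ^ (g.val * g'.val), ?_⟩
    rw [ZMod.val_add]
    rcases hval g with hg | hg <;> rcases hval g' with hg' | hg' <;> simp [hg, hg']
  · intro z _
    have h0 := Submodule.subset_span (R := ℝ) (Set.mem_range_self (f := fun g : ZMod 2 =>
      Complex.I ^ g.val) 0)
    have h1 := Submodule.subset_span (R := ℝ) (Set.mem_range_self (f := fun g : ZMod 2 =>
      Complex.I ^ g.val) 1)
    convert add_mem (Submodule.smul_mem _ z.re h0) (Submodule.smul_mem _ z.im h1)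
    simp [ZMod.val_one, Complex.re_add_im]

theorem isTwistedGroupAlgebra_gradingM2four : IsTwistedGroupAlgebra gradingM2four := by
  have hval (a : ZMod 2) : a.val = 0 ∨ a.val = 1 := by revert a; decide
  have hA : IsUnit (!![1, 0; 0, -1] : Matrix (Fin 2) (Fin 2) ℝ) := by
    simp [Matrix.isUnit_iff_isUnit_det]
  have hB : IsUnit (!![0, 1; 1, 0] : Matrix (Fin 2) (Fin 2) ℝ) := by
    simp [Matrix.isUnit_iff_isUnit_det]
  refine isTwistedGroupAlgebra_span_singleton (fun g => (hA.pow _).mul (hB.pow _)) (by simp)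
    (fun g g' => ⟨(-1) ^ (g.2.val * g'.1.val), ?_⟩) ?_ (by simp [Module.finrank_matrix])
  · rw [Prod.fst_add, Prod.snd_add, ZMod.val_add, ZMod.val_add]
    rcases hval g.1 with h1 | h1 <;> rcases hval g.2 with h2 | h2 <;>
      rcases hval g'.1 with h3 | h3 <;> rcases hval g'.2 with h4 | h4 <;>
      simp [h1, h2, h3, h4, Matrix.one_fin_two]
  · intro M _
    have hmem (g : ZMod 2 × ZMod 2) := Submodule.subset_span (R := ℝ) (Set.mem_range_self
      (f := fun g : ZMod 2 × ZMod 2 =>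
        (!![1, 0; 0, -1] ^ g.1.val * !![0, 1; 1, 0] ^ g.2.val : Matrix (Fin 2) (Fin 2) ℝ)) g)
    have hM : M = ((M 0 0 + M 1 1) / 2) • 1 + ((M 0 0 - M 1 1) / 2) • !![1, 0; 0, -1] +
        ((M 0 1 + M 1 0) / 2) • !![0, 1; 1, 0] +
        ((M 0 1 - M 1 0) / 2) • (!![1, 0; 0, -1] * !![0, 1; 1, 0]) := by
      ext i j
      fin_cases i <;> fin_cases j <;> simp <;> ring
    convert add_mem (add_mem (add_mem
      (Submodule.smul_mem _ ((M 0 0 + M 1 1) / 2) (hmem (0, 0)))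
      (Submodule.smul_mem _ ((M 0 0 - M 1 1) / 2) (hmem (1, 0))))
      (Submodule.smul_mem _ ((M 0 1 + M 1 0) / 2) (hmem (0, 1))))
      (Submodule.smul_mem _ ((M 0 1 - M 1 0) / 2) (hmem (1, 1)))
    simpa [ZMod.val_one] using hM

theorem isDivisionGrading_gradingH : IsDivisionGrading gradingH where
  gradedMonoid := { one_mem := Submodule.mem_top, mul_mem := fun _ _ _ _ _ _ => Submodule.mem_top }
  isInternal := isInternal_of_iSup_eq_top_of_sum_finrank iSup_const <| by
    rw [Fintype.sum_unique, gradingH, finrank_top]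
  isUnit _ _ _ hx0 := isUnit_iff_ne_zero.mpr hx0

end Models

section MatrixSplitting

/-- The homomorphism from `ℤ/n` sending `1` to an element killed by `n`. -/
noncomputable def zmodHom {G : Type*} [AddGroup G] {n : ℕ} {g : G} (hg : n • g = 0) : ZMod n →+ G :=
  ZMod.lift n ⟨zmultiplesHom G g, by simpa using hg⟩

theorem zmodHom_apply {G : Type*} [AddGroup G] {n : ℕ} [NeZero n] {g : G} (hg : n • g = 0)
    (m : ZMod n) : zmodHom hg m = m.val • g := by
  conv_lhs => rw [← ZMod.natCast_zmod_val m, ← Int.cast_natCast, zmodHom, ZMod.lift_coe]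
  exact natCast_zsmul g m.val

section MatrixAlgebra

variable {K : Type*} [Field K] [NeZero (2 : K)]

/-- The quaternion algebra with `i² = j² = 1` is the algebra of `2 × 2` matrices: here `i` and `j`
correspond to `diag(1, -1)` and `[0 1; 1 0]`. -/
def matrixTwoAlgEquiv : Matrix (Fin 2) (Fin 2) K ≃ₐ[K] ℍ[K,1,0,1] where
  toFun M := ⟨(M 0 0 + M 1 1) / 2, (M 0 0 - M 1 1) / 2, (M 0 1 + M 1 0) / 2, (M 0 1 - M 1 0) / 2⟩
  invFun x := !![x.re + x.imI, x.imJ + x.imK; x.imJ - x.imK, x.re - x.imI]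
  left_inv M := by
    have : (2 : K) ≠ 0 := NeZero.ne 2
    ext i j
    fin_cases i <;> fin_cases j <;> simp <;> field_simp <;> ring
  right_inv x := by ext <;> simp
  map_mul' M N := by
    have : (2 : K) ≠ 0 := NeZero.ne 2
    ext <;> simp [Matrix.mul_apply, Fin.sum_univ_two] <;> field_simp <;> ring
  map_add' M N := by ext <;> simp <;> ring
  commutes' r := by ext <;> simp [Matrix.algebraMap_matrix_apply]

theorem lift_matrixTwoAlgEquiv {R : Type*} [Ring R] [Algebra K R]
    (q : QuaternionAlgebra.Basis R (1 : K) 0 1) (M : Matrix (Fin 2) (Fin 2) K) :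
    q.lift (matrixTwoAlgEquiv M) = ((M 0 0 + M 1 1) / 2) • (1 : R) + ((M 0 0 - M 1 1) / 2) • q.i +
      ((M 0 1 + M 1 0) / 2) • q.j + ((M 0 1 - M 1 0) / 2) • q.k := by
  rw [← Algebra.algebraMap_eq_smul_one]
  rfl

end MatrixAlgebra

theorem bijective_ker_inf_ker_coprod {G : Type*} [AddCommGroup G] {b : G →+ G →+ ZMod 2} {a c : G}
    (haa : b a a = 0) (hac : b a c = 1) (hca : b c a = 1) (hcc : b c c = 0) (ha : 2 • a = 0)
    (hc : 2 • c = 0) :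
    Function.Bijective (((b a).ker ⊓ (b c).ker).subtype.coprod
      ((zmodHom ha).coprod (zmodHom hc))) := by
  have hba (p : ZMod 2 × ZMod 2) : b a ((zmodHom ha).coprod (zmodHom hc) p) = p.2 := by
    simp [zmodHom_apply, haa, hac]
  have hbc (p : ZMod 2 × ZMod 2) : b c ((zmodHom ha).coprod (zmodHom hc) p) = p.1 := by
    simp [zmodHom_apply, hca, hcc]
  constructor
  · rw [injective_iff_map_eq_zero]
    rintro ⟨⟨g, hga, hgc⟩, p⟩ hgp
    rw [AddMonoidHom.coprod_apply] at hgp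
    have h₂ := congrArg (b a) hgp
    have h₁ := congrArg (b c) hgp
    rw [map_add, hba, map_zero, AddSubgroup.coe_subtype, AddMonoidHom.mem_ker.mp hga,
      zero_add] at h₂
    rw [map_add, hbc, map_zero, AddSubgroup.coe_subtype, AddMonoidHom.mem_ker.mp hgc,
      zero_add] at h₁
    obtain rfl : p = 0 := Prod.ext h₁ h₂
    ext <;> simp_all
  · intro g
    refine ⟨(⟨g - (zmodHom ha).coprod (zmodHom hc) (b c g, b a g), ?_, ?_⟩, (b c g, b a g)), ?_⟩
    · exact AddMonoidHom.mem_ker.mpr (by rw [map_sub, hba, sub_self])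
    · exact AddMonoidHom.mem_ker.mpr (by rw [map_sub, hbc, sub_self])
    · rw [AddMonoidHom.coprod_apply]
      exact sub_add_cancel _ _

variable {G S : Type*} [AddCommGroup G] [Ring S] [Algebra ℝ S] {𝒜 : G → Submodule ℝ S}

theorem IsCommutationForm.iSup_centralizerGrading_ker {b : G →+ G →+ ZMod 2}
    (hb : IsCommutationForm 𝒜 b) (h : IsDivisionGrading 𝒜) {a c : G} {x y : S} (hx : x ∈ 𝒜 a)
    (hx0 : x ≠ 0) (hy : y ∈ 𝒜 c) (hy0 : y ≠ 0) :
    ⨆ k, centralizerGrading 𝒜 {x, y} ((b a).ker ⊓ (b c).ker).subtype k = ⊤ := by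
  refine h.iSup_centralizerGrading (by rintro _ (rfl | rfl); exacts [⟨a, hx⟩, ⟨c, hy⟩])
    fun g z hz hz0 hzc => ?_
  rw [AddSubgroup.range_subtype]
  exact ⟨hb.eq_zero_of_commute h hx hx0 hz hz0 (hzc x (by simp)),
    hb.eq_zero_of_commute h hy hy0 hz hz0 (hzc y (by simp))⟩

theorem IsDivisionGrading.lift_matrixTwoAlgEquiv_mem (h : IsDivisionGrading 𝒜)
    {q : QuaternionAlgebra.Basis S (1 : ℝ) 0 1} {a c : G} (hi : q.i ∈ 𝒜 a) (hj : q.j ∈ 𝒜 c)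
    (p : ZMod 2 × ZMod 2) (M : Matrix (Fin 2) (Fin 2) ℝ) (hM : M ∈ gradingM2four p) :
    q.lift (matrixTwoAlgEquiv M) ∈ 𝒜 (p.1.val • a + p.2.val • c) := by
  have hA : q.liftHom (matrixTwoAlgEquiv !![1, 0; 0, -1]) = q.i := by
    simpa using lift_matrixTwoAlgEquiv q !![1, 0; 0, -1]
  have hB : q.liftHom (matrixTwoAlgEquiv !![0, 1; 1, 0]) = q.j := by
    simpa using lift_matrixTwoAlgEquiv q !![0, 1; 1, 0]
  obtain ⟨r, rfl⟩ := Submodule.mem_span_singleton.mp hM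
  change q.liftHom _ ∈ _
  simp only [map_smul, map_mul, map_pow, hA, hB]
  exact Submodule.smul_mem _ _ (h.mul_mem (h.pow_mem hi _) (h.pow_mem hj _))

namespace IsTwistedGroupAlgebra

theorem two_nsmul_eq_zero (h : IsTwistedGroupAlgebra 𝒜) {g : G} {x : S} (hx : x ∈ 𝒜 g)
    (hxx : x * x = 1) : 2 • g = 0 := by
  have := h.nontrivial
  rw [two_nsmul]
  exact h.degree_eq (hxx ▸ h.mul_mem hx hx) h.one_mem one_ne_zero

theorem exists_weaklyIsomorphic_tensor_gradingM2four (h : IsTwistedGroupAlgebra 𝒜)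
    {J : S} (hJ : IsCentralImaginaryUnit J) {b : G →+ G →+ ZMod 2} (hb : IsCommutationForm 𝒜 b)
    {a c : G} {x y : S} (hx : x ∈ 𝒜 a) (hy : y ∈ 𝒜 c) (hxx : x * x = 1) (hyy : y * y = 1)
    (hac : b a c = 1) :
    ∃ (H : AddSubgroup G) (C : Subalgebra ℝ S) (𝒞 : H → Submodule ℝ C) (J' : C),
      Nat.card H * 4 = Nat.card G ∧ IsTwistedGroupAlgebra 𝒞 ∧ IsCentralImaginaryUnit J' ∧
        WeaklyIsomorphic (tensorGrading 𝒞 gradingM2four) 𝒜 := by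
  let q := quaternionBasisOfAnticommute (c₁ := (1 : ℝ)) (c₂ := 1) (by simpa using hxx)
    (by simpa using hyy) (hb.mul_eq_neg_mul hx hy hac)
  have ha := h.two_nsmul_eq_zero hx hxx
  have hc := h.two_nsmul_eq_zero hy hyy
  have hca : b c a = 1 := hb.symm h a c ▸ hac
  have hbij := bijective_ker_inf_ker_coprod (hb.apply_self h a) hac hca (hb.apply_self h c) ha hc
  let H := (b a).ker ⊓ (b c).ker
  have htop : ⨆ k, centralizerGrading 𝒜 {q.i, q.j} H.subtype k = ⊤ := by
    have := h.nontrivial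
    exact hb.iSup_centralizerGrading_ker h.toIsDivisionGrading hx (by rintro rfl; simp at hxx) hy
      (by rintro rfl; simp at hyy)
  have hiso := h.weaklyIsomorphic_centralizer_tensor one_ne_zero one_ne_zero htop
    isTwistedGroupAlgebra_gradingM2four.iSup_eq_top matrixTwoAlgEquiv
    (β := (zmodHom ha).coprod (zmodHom hc)) (fun p M hM => by
      simpa [zmodHom_apply] using h.lift_matrixTwoAlgEquiv_mem (q := q) hx hy p M hM) hbij
  refine ⟨H, _, centralizerGrading 𝒜 {q.i, q.j} H.subtype, _, ?_,
    ⟨h.centralizer H.subtype_injective htop, fun k => ?_⟩,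
    hJ.centralizer q one_ne_zero one_ne_zero, hiso⟩
  · simpa [H] using Nat.card_congr (Equiv.ofBijective _ hbij)
  · have := hiso.symm.finrank_eq h.finrank_eq_one (k, 0)
    rw [finrank_tensorGrading] at this
    exact Nat.eq_one_of_mul_eq_one_right this

end IsTwistedGroupAlgebra

end MatrixSplitting

section BaseCases

theorem exists_two_nsmul_eq_zero_apply_eq_one {G : Type*} [AddCommGroup G] {f : G →+ ZMod 2} {a : G}
    (hfa : f a = 0) (ha : ∀ g, 2 • g = 0 ∨ 2 • g = 2 • a) (hf : f ≠ 0) :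
    ∃ t, 2 • t = 0 ∧ f t = 1 := by
  obtain ⟨g, hg⟩ := DFunLike.ne_iff.mp hf
  have hg1 : f g = 1 := Fin.eq_one_of_ne_zero _ hg
  obtain h2 | h2 := ha g
  · exact ⟨g, h2, hg1⟩
  · exact ⟨g - a, by rw [smul_sub, h2, sub_self], by rw [map_sub, hfa, sub_zero, hg1]⟩

theorem bijective_zmodHom_coprod_zmodHom {G : Type*} [AddCommGroup G] {b : G →+ G →+ ZMod 2}
    (hself : ∀ g, b g g = 0) (hsymm : ∀ g g', b g g' = b g' g) {e a t : G} (he : e ≠ 0)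
    (hrad : ∀ g, b g = 0 → g = 0 ∨ g = e) (hT : ∀ g g', 2 • g = 0 → 2 • g' = 0 → b g g' = 0)
    (ha : 2 • a = e) (ha4 : 4 • a = 0) (ht : 2 • t = 0) (hat : b a t = 1) :
    Function.Bijective ((zmodHom ha4).coprod (zmodHom ht)) := by
  have hf (p : ZMod 4 × ZMod 2) :
      (zmodHom ha4).coprod (zmodHom ht) p = p.1.val • a + p.2.val • t := by
    simp [zmodHom_apply]
  have hb (p : ZMod 4 × ZMod 2) : b a ((zmodHom ha4).coprod (zmodHom ht) p) = p.2 := by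
    simp [hf, hself, hat]
  have hcase (g : G) : ∃ p : ZMod 4, 2 • (g - p.val • a) = 0 := by
    obtain hg | hg := hrad (2 • g) (by ext; simp [CharTwo.two_eq_zero])
    · exact ⟨0, by simpa using hg⟩
    · exact ⟨1, by rw [smul_sub, hg, show (1 : ZMod 4).val = 1 from rfl, one_nsmul, ha, sub_self]⟩
  have hzero (g : G) (hg : 2 • g = 0) (hag : b a g = 0) : b g = 0 := by
    ext g'
    obtain ⟨p, hp⟩ := hcase g'
    rw [← sub_add_cancel g' (p.val • a), map_add, hT g _ hg hp, map_nsmul, hsymm g a, hag]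
    simp
  constructor
  · rw [injective_iff_map_eq_zero]
    rintro ⟨p, r⟩ hpr
    obtain rfl : r = 0 := by simpa [hpr] using (hb (p, r)).symm
    have horder : addOrderOf a = 4 :=
      addOrderOf_eq_prime_pow (p := 2) (n := 1) (by simpa [ha] using he) ha4
    have hp : addOrderOf a ∣ p.val := addOrderOf_dvd_iff_nsmul_eq_zero.mpr (by simpa [hf] using hpr)
    rw [Prod.mk_eq_zero, ← ZMod.val_eq_zero]
    exact ⟨Nat.eq_zero_of_dvd_of_lt hp (p.val_lt.trans_eq horder.symm), rfl⟩
  · intro g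
    obtain ⟨p, hp⟩ := hcase g
    have h2 : 2 • (g - (zmodHom ha4).coprod (zmodHom ht) (p, b a g)) = 0 := by
      rw [hf, ← sub_sub, smul_sub, hp, smul_comm, ht, smul_zero, sub_zero]
    obtain hg | hg := hrad _ (hzero _ h2 (by rw [map_sub, hb, sub_self]))
    · exact ⟨_, (sub_eq_zero.mp hg).symm⟩
    · refine ⟨(p, b a g) + (2, 0), ?_⟩
      rw [map_add, eq_comm, ← sub_eq_iff_eq_add', hg, hf, ← ha]
      simp [show (2 : ZMod 4).val = 2 from rfl]

theorem IsTwistedGroupAlgebra.weaklyIsomorphic_of_injective {G H R S : Type*} [AddCommGroup G]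
    [AddCommGroup H] [Ring R] [Algebra ℝ R] [Ring S] [Algebra ℝ S] {𝒜 : G → Submodule ℝ R}
    {ℬ : H → Submodule ℝ S} (hℬ : IsTwistedGroupAlgebra ℬ) {φ : R →ₐ[ℝ] S} {α : G →+ H}
    (h𝒜 : ∀ g, 𝒜 g ≠ ⊥) (hφ : Function.Injective φ) (hα : Function.Bijective α)
    (h : ∀ g, ∀ x ∈ 𝒜 g, φ x ∈ ℬ (α g)) : WeaklyIsomorphic 𝒜 ℬ := by
  have hmap (g : G) : (𝒜 g).map φ.toLinearMap = ℬ (α g) :=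
    hℬ.eq_of_le
      (((Submodule.map_injective_of_injective hφ).ne_iff' (Submodule.map_bot _)).mpr (h𝒜 g))
      (Submodule.map_le_iff_le_comap.mpr (h g))
  have hsurj : Function.Surjective φ := by
    rw [← AlgHom.coe_toLinearMap, ← LinearMap.range_eq_top, ← top_le_iff, ← hℬ.iSup_eq_top]
    refine iSup_le fun k => ?_
    obtain ⟨g, rfl⟩ := hα.2 k
    exact hmap g ▸ LinearMap.map_le_range
  exact ⟨.ofBijective φ ⟨hφ, hsurj⟩, .ofBijective α hα, hmap⟩

section ComplexMatrices

variable {S : Type*} [Ring S] [Algebra ℝ S]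

/-- The homomorphism from `M₂(ℂ)` sending the imaginary unit to the central element `J`, and the
matrices `diag(1, -1)` and `[0 1; 1 0]` to the basis elements `i` and `j` of `q`. -/
noncomputable def complexMatrixHom (q : QuaternionAlgebra.Basis S (1 : ℝ) 0 1) {J : S}
    (hJ : J * J = -1) (hcomm : ∀ x, Commute J x) : Matrix (Fin 2) (Fin 2) ℂ →ₐ[ℝ] S :=
  (Algebra.TensorProduct.lift (Complex.lift ⟨J, hJ⟩) (q.liftHom.comp matrixTwoAlgEquiv.toAlgHom)
    fun z M => by
      rw [Complex.lift_apply, Complex.liftAux_apply]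
      exact (Algebra.commute_algebraMap_left _ _).add_left ((hcomm _).smul_left _)).comp
    (matrixEquivTensor (Fin 2) ℝ ℂ).toAlgHom

theorem complexMatrixHom_smul_map (q : QuaternionAlgebra.Basis S (1 : ℝ) 0 1) {J : S}
    (hJ : J * J = -1) (hcomm : ∀ x, Commute J x) (z : ℂ) (M : Matrix (Fin 2) (Fin 2) ℝ) :
    complexMatrixHom q hJ hcomm (z • M.map (algebraMap ℝ ℂ)) =
      (algebraMap ℝ S z.re + z.im • J) * q.lift (matrixTwoAlgEquiv M) := by
  rw [← matrixEquivTensor_apply_symm]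
  simp only [complexMatrixHom, AlgHom.comp_apply, AlgEquiv.coe_toAlgHom, AlgEquiv.apply_symm_apply,
    Algebra.TensorProduct.lift_tmul, Complex.lift_apply, Complex.liftAux_apply]
  rfl

end ComplexMatrices

namespace IsCentralImaginaryUnit

variable {G S : Type*} [AddCommGroup G] [Ring S] [Algebra ℝ S] {𝒜 : G → Submodule ℝ S}
  {J : S} (hJ : IsCentralImaginaryUnit J) (h : IsTwistedGroupAlgebra 𝒜)
include hJ h

theorem weaklyIsomorphic_gradingCtwo {e : G} (he : J ∈ 𝒜 e) (hG : ∀ g, g = 0 ∨ g = e) :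
    WeaklyIsomorphic gradingCtwo 𝒜 := by
  have := h.nontrivial
  have hee : 2 • e = 0 := (two_nsmul e).trans (hJ.degree_add_degree h he)
  refine h.weaklyIsomorphic_of_injective (φ := Complex.lift ⟨J, hJ.mul_self⟩) (α := zmodHom hee)
    isTwistedGroupAlgebra_gradingCtwo.ne_bot (RingHom.injective _) ⟨?_, fun g => ?_⟩
    fun g x hx => ?_
  · refine (injective_iff_map_eq_zero _).mpr fun m hm => ?_
    by_contra hm0
    obtain rfl : m = 1 := Fin.eq_one_of_ne_zero m hm0
    exact hJ.degree_ne_zero h he (by simpa [zmodHom_apply, ZMod.val_one] using hm)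
  · obtain rfl | rfl := hG g
    · exact ⟨0, map_zero _⟩
    · exact ⟨1, by simp [zmodHom_apply, ZMod.val_one]⟩
  · obtain ⟨c, rfl⟩ := Submodule.mem_span_singleton.mp hx
    rw [map_smul, map_pow, zmodHom_apply]
    refine (𝒜 _).smul_mem _ (h.pow_mem ?_ _)
    simpa [Complex.liftAux_apply] using he

omit h in
theorem exists_quaternionBasis {u v : S} (huu : u * u = J) (hvv : v * v = -1)
    (huv : u * v = -(v * u)) : ∃ q : QuaternionAlgebra.Basis S (1 : ℝ) 0 1,
      (√2)⁻¹ • ((1 + J) * q.i) = u ∧ q.k = v := by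
  have hs : (√2)⁻¹ * (√2)⁻¹ = (2 : ℝ)⁻¹ := by rw [← mul_inv, Real.mul_self_sqrt zero_le_two]
  have hsq : (1 - J) * (1 - J) = (-2 : ℝ) • J := by
    rw [sub_mul, one_mul, mul_sub, mul_one, hJ.mul_self]
    module
  have hcomm (y : S) : Commute (1 - J) y := (Commute.one_left y).sub_left (hJ.commute y)
  have hdiff : (1 + J) * (1 - J) = (2 : ℝ) • 1 := by
    rw [add_mul, one_mul, mul_sub, mul_one, hJ.mul_self]
    module
  let x := (√2)⁻¹ • ((1 - J) * u)
  have hvx : v * x = -(x * v) := by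
    rw [smul_mul_assoc, mul_smul_comm, mul_assoc, huv, mul_neg, (hcomm v).left_comm, smul_neg,
      neg_neg]
  have hxx : x * x = 1 := by
    rw [smul_mul_smul_comm, hs, (hcomm u).symm.mul_mul_mul_comm, hsq, huu, smul_mul_assoc,
      hJ.mul_self]
    module
  refine ⟨quaternionBasisOfAnticommute (x := x) (y := x * v) (by rwa [one_smul]) ?_ ?_, ?_, ?_⟩
  · rw [mul_assoc, ← mul_assoc v, hvx, neg_mul, mul_assoc, hvv]
    simpa using hxx
  · rw [mul_assoc, hvx, mul_neg, neg_neg]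
  · change (√2)⁻¹ • ((1 + J) * x) = u
    rw [mul_smul_comm, smul_smul, hs, ← mul_assoc, hdiff, smul_mul_assoc, one_mul]
    module
  · change x * (x * v) = v
    rw [← mul_assoc, hxx, one_mul]

theorem weaklyIsomorphic_gradingM2eight {a t : G} {u v : S} (hu : u ∈ 𝒜 a) (hv : v ∈ 𝒜 t)
    (huu : u * u = J) (hvv : v * v = -1) (huv : u * v = -(v * u)) (ha : 4 • a = 0) (ht : 2 • t = 0)
    (hbij : Function.Bijective ((zmodHom ha).coprod (zmodHom ht))) :
    WeaklyIsomorphic gradingM2eight 𝒜 := by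
  have := h.nontrivial
  obtain ⟨q, hqu, hqv⟩ := hJ.exists_quaternionBasis huu hvv huv
  let φ := complexMatrixHom q hJ.mul_self hJ.commute
  have hA : φ (((1 + Complex.I) / (√2 : ℂ)) • !![1, 0; 0, -1]) = u := by
    rw [← hqu]
    convert complexMatrixHom_smul_map q hJ.mul_self hJ.commute ((1 + Complex.I) / √2)
      !![1, 0; 0, -1] using 1
    · congr 2
      ext i j
      fin_cases i <;> fin_cases j <;> simp
    · rw [lift_matrixTwoAlgEquiv]
      simp [Algebra.algebraMap_eq_smul_one, ← smul_add]
  have hC : φ !![0, 1; -1, 0] = v := by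
    rw [← hqv]
    convert complexMatrixHom_smul_map q hJ.mul_self hJ.commute 1 !![0, 1; -1, 0] using 1
    · congr 1
      ext i j
      fin_cases i <;> fin_cases j <;> simp
    · simp [lift_matrixTwoAlgEquiv]
  refine h.weaklyIsomorphic_of_injective (φ := φ) (fun g => ?_) (RingHom.injective _)
    hbij fun g M hM => ?_
  · rw [gradingM2eight, Ne, Submodule.span_singleton_eq_bot]
    refine IsUnit.ne_zero ((IsUnit.pow _ ?_).mul (IsUnit.pow _ ?_)) <;>
      simp [Matrix.isUnit_iff_isUnit_det, Complex.ext_iff]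
  · obtain ⟨c, rfl⟩ := Submodule.mem_span_singleton.mp hM
    rw [map_smul, map_mul, map_pow, map_pow, hA, hC, AddMonoidHom.coprod_apply,
      zmodHom_apply, zmodHom_apply]
    exact (𝒜 _).smul_mem _ (h.mul_mem (h.pow_mem hu _) (h.pow_mem hv _))

end IsCentralImaginaryUnit

end BaseCases

section Classification

namespace IsCentralImaginaryUnit

variable {G S : Type*} [AddCommGroup G] [Ring S] [Algebra ℝ S] {𝒜 : G → Submodule ℝ S}
  {J : S} (hJ : IsCentralImaginaryUnit J) (h : IsTwistedGroupAlgebra 𝒜) {b : G →+ G →+ ZMod 2}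
  (hb : IsCommutationForm 𝒜 b)
include hJ h hb

theorem weaklyIsomorphic_gradingM2eight_of_two_nsmul_ne_zero
    (hT : ∀ g g', 2 • g = 0 → 2 • g' = 0 → b g g' = 0) {g₀ : G} (hg₀ : 2 • g₀ ≠ 0) :
    WeaklyIsomorphic gradingM2eight 𝒜 := by
  obtain ⟨e, he⟩ := hJ.exists_mem h
  have hrad (g : G) : b g = 0 ↔ g = 0 ∨ g = e := hJ.commutationForm_eq_zero_iff h he hb
  have hee := hJ.degree_add_degree h he
  have hdouble (g : G) : 2 • g = 0 ∨ 2 • g = e :=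
    (hrad _).mp (by ext; simp [CharTwo.two_eq_zero])
  have hg₀e : g₀ + g₀ = e := two_nsmul g₀ ▸ (hdouble g₀).resolve_left hg₀
  obtain ⟨a, hag₀, -, u, hu, huu⟩ := hJ.exists_mul_self_eq h he hb (hg₀e.symm ▸ he)
  have ha : 2 • a = e := by rw [two_nsmul, hag₀, hg₀e]
  have hba : b a ≠ 0 := by
    rw [Ne, hrad]
    rintro (rfl | rfl)
    · exact hJ.degree_ne_zero h he (by rw [← ha, smul_zero])
    · exact hJ.degree_ne_zero h he (by rw [← ha, two_nsmul, hee])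
  obtain ⟨t₀, ht₀, hat₀⟩ :=
    exists_two_nsmul_eq_zero_apply_eq_one (hb.apply_self h a) (ha.symm ▸ hdouble) hba
  have ht₀' : t₀ + t₀ = 0 := two_nsmul t₀ ▸ ht₀
  obtain ⟨t, htt, hbt, v, hv, hvv⟩ :=
    hJ.exists_mul_self_eq h he hb (ht₀'.symm ▸ (𝒜 0).neg_mem h.one_mem)
  have hat : b a t = 1 := by
    rw [hb.symm h, hbt, hb.symm h, hat₀]
  have ht : 2 • t = 0 := by rw [two_nsmul, htt, ht₀']
  have ha4 : 4 • a = 0 := by rw [show 4 = 2 * 2 from rfl, mul_smul, ha, two_nsmul, hee]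
  exact hJ.weaklyIsomorphic_gradingM2eight h hu hv huu hvv (hb.mul_eq_neg_mul hu hv hat) ha4 ht
    (bijective_zmodHom_coprod_zmodHom (hb.apply_self h)
      (hb.symm h) (hJ.degree_ne_zero h he) (fun g => (hrad g).mp) hT ha ha4 ht
      hat)

theorem weaklyIsomorphic_gradingCtwo_or_gradingM2eight
    (hT : ∀ g g', 2 • g = 0 → 2 • g' = 0 → b g g' = 0) :
    WeaklyIsomorphic gradingCtwo 𝒜 ∨ WeaklyIsomorphic gradingM2eight 𝒜 := by
  by_cases hG : ∀ g : G, 2 • g = 0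
  · obtain ⟨e, he⟩ := hJ.exists_mem h
    exact .inl (hJ.weaklyIsomorphic_gradingCtwo h he fun g =>
      (hJ.commutationForm_eq_zero_iff h he hb).mp
        (AddMonoidHom.ext fun g' => hT g g' (hG g) (hG g')))
  · push Not at hG
    obtain ⟨g₀, hg₀⟩ := hG
    exact .inr (hJ.weaklyIsomorphic_gradingM2eight_of_two_nsmul_ne_zero h hb hT hg₀)

theorem exists_weaklyIsomorphic_tensor_gradingM2four {g g' : G} (hg : 2 • g = 0)
    (hg' : 2 • g' = 0) (hgg' : b g g' ≠ 0) :
    ∃ (H : AddSubgroup G) (C : Subalgebra ℝ S) (𝒞 : H → Submodule ℝ C) (J' : C),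
      Nat.card H * 4 = Nat.card G ∧ IsTwistedGroupAlgebra 𝒞 ∧ IsCentralImaginaryUnit J' ∧
        WeaklyIsomorphic (tensorGrading 𝒞 gradingM2four) 𝒜 := by
  obtain ⟨e, he⟩ := hJ.exists_mem h
  rw [two_nsmul] at hg hg'
  obtain ⟨a, -, ha, x, hx, hxx⟩ := hJ.exists_mul_self_eq h he hb (hg.symm ▸ h.one_mem)
  obtain ⟨c, -, hc, y, hy, hyy⟩ := hJ.exists_mul_self_eq h he hb (hg'.symm ▸ h.one_mem)
  refine h.exists_weaklyIsomorphic_tensor_gradingM2four hJ hb hx hy hxx hyy ?_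
  rw [ha, hb.symm h, hc, hb.symm h]
  exact Fin.eq_one_of_ne_zero _ hgg'

end IsCentralImaginaryUnit

theorem IsTwistedGroupAlgebra.exists_weaklyIsomorphic {G S : Type*} [AddCommGroup G] [Finite G]
    [Ring S] [Algebra ℝ S] {𝒜 : G → Submodule ℝ S} (h : IsTwistedGroupAlgebra 𝒜) {J : S}
    (hJ : IsCentralImaginaryUnit J) :
    ∃ k, WeaklyIsomorphic 𝒜 (tensorGrading (tensorPowerGrading gradingM2four k) gradingCtwo) ∨
      WeaklyIsomorphic 𝒜 (tensorGrading gradingM2eight (tensorPowerGrading gradingM2four k)) := by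
  induction hn : Nat.card G using Nat.strong_induction_on generalizing G S with
  | h n ih =>
    obtain ⟨b, hb⟩ := h.exists_commutationForm
    by_cases hT : ∀ g g', 2 • g = 0 → 2 • g' = 0 → b g g' = 0
    · refine ⟨0, (hJ.weaklyIsomorphic_gradingCtwo_or_gradingM2eight h hb hT).imp
        (fun hC => hC.symm.trans ?_) fun hM => hM.symm.trans ?_⟩
      · exact ((WeaklyIsomorphic.tensor_comm _ _).trans (.tensor_tensorPower_zero _ _)).symm
      · exact (WeaklyIsomorphic.tensor_tensorPower_zero _ _).symm
    · push Not at hT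
      obtain ⟨g, g', hg, hg', hgg'⟩ := hT
      obtain ⟨H, C, 𝒞, J', hcard, h𝒞, hJ', hiso⟩ :=
        hJ.exists_weaklyIsomorphic_tensor_gradingM2four h hb hg hg' hgg'
      have hpos : 0 < Nat.card H := Nat.card_pos
      obtain ⟨k, hk⟩ := ih (Nat.card H) (by lia) h𝒞 hJ' rfl
      refine ⟨k + 1, hk.imp (fun hC => ?_) fun hM => ?_⟩
      · exact hiso.symm.trans <| (hC.tensor (.refl _)).trans <|
          (WeaklyIsomorphic.tensor_right_comm _ _ _).trans <|
            (WeaklyIsomorphic.tensorPower_succ _ k).symm.tensor (.refl _)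
      · exact hiso.symm.trans <| (hM.tensor (.refl _)).trans <|
          (WeaklyIsomorphic.tensor_assoc _ _ _).trans <|
            (WeaklyIsomorphic.refl _).tensor (WeaklyIsomorphic.tensorPower_succ _ k).symm

end Classification

section QuaternionSplitting

theorem IsDivisionGrading.exists_weaklyIsomorphic_tensor_gradingH {G R : Type*} [AddCommGroup G]
    [Ring R] [Algebra ℝ R] {𝒜 : G → Submodule ℝ R} (h : IsDivisionGrading 𝒜)
    (h4 : ∀ g, Module.finrank ℝ (𝒜 g) = 4) {J : R} (hJ : IsCentralImaginaryUnit J) :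
    ∃ (C : Subalgebra ℝ R) (𝒞 : G → Submodule ℝ C) (J' : C), IsTwistedGroupAlgebra 𝒞 ∧
      IsCentralImaginaryUnit J' ∧ WeaklyIsomorphic 𝒜 (tensorGrading 𝒞 gradingH) := by
  obtain ⟨f, -, hrange⟩ := h.exists_quaternion_algHom (h4 0)
  let q : QuaternionAlgebra.Basis R (-1 : ℝ) 0 (-1) := (QuaternionAlgebra.Basis.self ℝ).compHom f
  have hf (x : ℍ[ℝ]) : f x ∈ 𝒜 0 := hrange ▸ LinearMap.mem_range_self f.toLinearMap x
  have hq (x : ℍ[ℝ]) : q.lift x = f x :=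
    DFunLike.congr_fun (QuaternionAlgebra.lift.apply_symm_apply f) x
  have hne : (-1 : ℝ) ≠ 0 := neg_ne_zero.mpr one_ne_zero
  have htop : ⨆ g, centralizerGrading 𝒜 {q.i, q.j} (.id G) g = ⊤ :=
    h.iSup_centralizerGrading (by rintro _ (rfl | rfl); exacts [⟨0, hf _⟩, ⟨0, hf _⟩])
      fun g _ _ _ _ => ⟨g, rfl⟩
  have hiso := h.weaklyIsomorphic_centralizer_tensor (ℬ := gradingH) (β := 0) hne hne htop
    iSup_const .refl (fun _ x _ => Set.mem_of_eq_of_mem (hq x) (hf x))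
    ⟨fun p p' hp => Prod.ext (by simpa using hp) rfl, fun g => ⟨(g, ()), by simp⟩⟩
  refine ⟨_, _, _, ⟨h.centralizer Function.injective_id htop, fun g => ?_⟩,
    hJ.centralizer q hne hne, hiso.symm⟩
  have := hiso.symm.finrank_eq h4 (g, ())
  rw [finrank_tensorGrading, gradingH, finrank_top, Quaternion.finrank_eq_four] at this
  lia

end QuaternionSplitting

section MatrixAlgebras

/-- The tensor product of two matrix algebras as a matrix algebra. -/
noncomputable def matrixTensorAlgEquiv (m n : ℕ) (A : Type*) [Ring A] [Algebra ℝ A] :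
    Matrix (Fin m) (Fin m) ℝ ⊗[ℝ] Matrix (Fin n) (Fin n) A ≃ₐ[ℝ]
      Matrix (Fin (m * n)) (Fin (m * n)) A :=
  ((Matrix.kroneckerTMulAlgEquiv (Fin m) (Fin n) ℝ ℝ ℝ A).trans
    (Algebra.TensorProduct.lid ℝ A).mapMatrix).trans (Matrix.reindexAlgEquiv ℝ A finProdFinEquiv)

theorem nonempty_tensorPower_matrixTwo_algEquiv (k : ℕ) :
    Nonempty ((⨂[ℝ] _ : Fin k, Matrix (Fin 2) (Fin 2) ℝ) ≃ₐ[ℝ]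
      Matrix (Fin (2 ^ k)) (Fin (2 ^ k)) ℝ) := by
  induction k with
  | zero =>
    have hbij : Function.Bijective (Algebra.ofId ℝ (Matrix (Fin 1) (Fin 1) ℝ)) :=
      ⟨RingHom.injective _, fun M => ⟨M 0 0, by ext i j; fin_cases i; fin_cases j; rfl⟩⟩
    exact ⟨(emptyTensorPowerAlgEquiv _).trans (.ofBijective _ hbij)⟩
  | succ k ih =>
    obtain ⟨e⟩ := ih
    rw [pow_succ]
    exact ⟨((tensorPowerSuccAlgEquiv _ k).trans (Algebra.TensorProduct.congr e .refl)).trans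
      (matrixTensorAlgEquiv (2 ^ k) 2 ℝ)⟩

theorem nonempty_complex_tensor_quaternion_algEquiv :
    Nonempty (ℂ ⊗[ℝ] ℍ[ℝ] ≃ₐ[ℝ] Matrix (Fin 2) (Fin 2) ℂ) := by
  let q : QuaternionAlgebra.Basis (Matrix (Fin 2) (Fin 2) ℂ) (-1 : ℝ) 0 (-1) :=
    quaternionBasisOfAnticommute (x := !![Complex.I, 0; 0, -Complex.I]) (y := !![0, 1; -1, 0])
      (by simp [Matrix.one_fin_two]) (by simp [Matrix.one_fin_two]) (by simp)
  obtain ⟨φ, hφ⟩ : ∃ φ : ℂ ⊗[ℝ] ℍ[ℝ] →ₐ[ℝ] Matrix (Fin 2) (Fin 2) ℂ,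
      ∀ z x, φ (z ⊗ₜ x) = z • q.lift x :=
    ⟨Algebra.TensorProduct.lift ((Algebra.ofId ℂ _).restrictScalars ℝ) q.liftHom
      fun z x => Algebra.commute_algebraMap_left z (q.lift x), fun z x =>
      (Algebra.TensorProduct.lift_tmul ..).trans (Algebra.smul_def z (q.lift x)).symm⟩
  have h1 : q.lift (1 : ℍ[ℝ]) = 1 := q.lift_one
  obtain ⟨xi, hi⟩ : ∃ x : ℍ[ℝ], q.lift x = q.i :=
    ⟨⟨0, 1, 0, 0⟩, by simp [QuaternionAlgebra.Basis.lift]⟩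
  obtain ⟨xj, hj⟩ : ∃ x : ℍ[ℝ], q.lift x = q.j :=
    ⟨⟨0, 0, 1, 0⟩, by simp [QuaternionAlgebra.Basis.lift]⟩
  obtain ⟨xk, hk⟩ : ∃ x : ℍ[ℝ], q.lift x = q.k :=
    ⟨⟨0, 0, 0, 1⟩, by simp [QuaternionAlgebra.Basis.lift]⟩
  have hsurj : Function.Surjective φ.toLinearMap := fun M => by
    refine ⟨((M 0 0 + M 1 1) / 2) ⊗ₜ 1 + (-Complex.I * (M 0 0 - M 1 1) / 2) ⊗ₜ xi +
      ((M 0 1 - M 1 0) / 2) ⊗ₜ xj + (-Complex.I * (M 0 1 + M 1 0) / 2) ⊗ₜ xk, ?_⟩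
    rw [AlgHom.toLinearMap_apply, map_add, map_add, map_add, hφ, hφ, hφ, hφ, h1, hi, hj, hk]
    ext i j
    fin_cases i <;> fin_cases j <;> simp [q, quaternionBasisOfAnticommute] <;>
      grind [Complex.I_mul_I]
  have hdim : Module.finrank ℝ (ℂ ⊗[ℝ] ℍ[ℝ]) = Module.finrank ℝ (Matrix (Fin 2) (Fin 2) ℂ) := by
    simp [Module.finrank_matrix, Quaternion.finrank_eq_four]
  exact ⟨.ofBijective φ
    ⟨(LinearMap.injective_iff_surjective_of_finrank_eq_finrank hdim).mpr hsurj, hsurj⟩⟩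

theorem nonempty_tensor_complex_tensor_quaternion_algEquiv {P : Type*} [Ring P] [Algebra ℝ P]
    {n : ℕ} (e : P ≃ₐ[ℝ] Matrix (Fin n) (Fin n) ℝ) :
    Nonempty ((P ⊗[ℝ] ℂ) ⊗[ℝ] ℍ[ℝ] ≃ₐ[ℝ] Matrix (Fin (n * 2)) (Fin (n * 2)) ℂ) := by
  obtain ⟨e'⟩ := nonempty_complex_tensor_quaternion_algEquiv
  exact ⟨(Algebra.TensorProduct.assoc ℝ ℝ ℝ P ℂ ℍ[ℝ]).trans
    ((Algebra.TensorProduct.congr e e').trans (matrixTensorAlgEquiv n 2 ℂ))⟩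

theorem nonempty_matrixTwo_tensor_tensor_quaternion_algEquiv {P : Type*} [Ring P] [Algebra ℝ P]
    {n : ℕ} (e : P ≃ₐ[ℝ] Matrix (Fin n) (Fin n) ℝ) :
    Nonempty ((Matrix (Fin 2) (Fin 2) ℂ ⊗[ℝ] P) ⊗[ℝ] ℍ[ℝ] ≃ₐ[ℝ]
      Matrix (Fin (n * 2 * 2)) (Fin (n * 2 * 2)) ℂ) := by
  obtain ⟨e'⟩ := nonempty_tensor_complex_tensor_quaternion_algEquiv
    ((Algebra.TensorProduct.congr e .refl).trans (matrixTensorAlgEquiv n 2 ℝ))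
  let e₁ := (matrixEquivTensor (Fin 2) ℝ ℂ).trans
    (Algebra.TensorProduct.comm ℝ ℂ (Matrix (Fin 2) (Fin 2) ℝ))
  let e₂ : Matrix (Fin 2) (Fin 2) ℂ ⊗[ℝ] P ≃ₐ[ℝ] (P ⊗[ℝ] Matrix (Fin 2) (Fin 2) ℝ) ⊗[ℝ] ℂ :=
    (Algebra.TensorProduct.comm ℝ _ P).trans ((Algebra.TensorProduct.congr .refl e₁).trans
      (Algebra.TensorProduct.assoc ℝ ℝ ℝ P _ ℂ).symm)
  exact ⟨(Algebra.TensorProduct.congr e₂ .refl).trans e'⟩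

theorem nonempty_matrix_complex_algEquiv_iff {m n : ℕ} :
    Nonempty (Matrix (Fin m) (Fin m) ℂ ≃ₐ[ℝ] Matrix (Fin n) (Fin n) ℂ) ↔ m = n := by
  refine ⟨fun ⟨e⟩ => ?_, fun h => h ▸ ⟨.refl⟩⟩
  have := e.toLinearEquiv.finrank_eq
  simpa [Module.finrank_matrix, ← sq] using this

theorem isCentralImaginaryUnit_matrix (n : ℕ) :
    IsCentralImaginaryUnit (Complex.I • (1 : Matrix (Fin n) (Fin n) ℂ)) where
  mul_self := by simp [smul_smul]
  mem_center_iff {x} := by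
    have hsmul (p q : ℝ) : p • (1 : Matrix (Fin n) (Fin n) ℂ) + q • Complex.I • 1 =
        algebraMap ℂ _ (p + q * Complex.I) := by
      rw [Algebra.algebraMap_eq_smul_one, add_smul, mul_smul]
      rfl
    rw [Subalgebra.mem_center_iff, ← Subalgebra.mem_center_iff (R := ℂ),
      Algebra.IsCentral.mem_center_iff]
    simp only [hsmul]
    exact ⟨fun ⟨z, hz⟩ => ⟨z.re, z.im, by rw [hz, Complex.re_add_im]⟩, fun ⟨p, q, hx⟩ => ⟨_, hx⟩⟩

end MatrixAlgebras

section ExistenceModel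

theorem isDivisionGrading_tensor_gradingH (k : ℕ) :
    IsDivisionGrading
      (tensorGrading (tensorGrading (tensorPowerGrading gradingM2four k) gradingCtwo) gradingH) :=
  (WeaklyIsomorphic.tensor_assoc _ _ _).symm.isDivisionGrading
    (isTwistedGroupAlgebra_gradingM2four.isDivisionGrading_tensor_tensorPower
      (isTwistedGroupAlgebra_gradingCtwo.isDivisionGrading_tensor isDivisionGrading_gradingH) k)

theorem finrank_tensor_gradingH (k : ℕ) (p) : Module.finrank ℝ
    (tensorGrading (tensorGrading (tensorPowerGrading gradingM2four k) gradingCtwo) gradingH p) =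
      4 := by
  rw [finrank_tensorGrading, finrank_tensorGrading,
    isTwistedGroupAlgebra_gradingM2four.finrank_tensorPowerGrading,
    isTwistedGroupAlgebra_gradingCtwo.finrank_eq_one, gradingH, finrank_top,
    Quaternion.finrank_eq_four]

end ExistenceModel

section QuaternionicClassification

theorem exists_isDivisionGrading_finrank_eq_four {R : Type*} [Ring R] [Algebra ℝ R] {k : ℕ}
    (e : R ≃ₐ[ℝ] Matrix (Fin (2 ^ (k + 1))) (Fin (2 ^ (k + 1))) ℂ) :
    ∃ (G : Type) (_ : AddCommGroup G) (𝒜 : G → Submodule ℝ R),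
      IsDivisionGrading 𝒜 ∧ ∀ g, Module.finrank ℝ (𝒜 g) = 4 := by
  obtain ⟨e₁⟩ := nonempty_tensorPower_matrixTwo_algEquiv k
  obtain ⟨e₂⟩ := nonempty_tensor_complex_tensor_quaternion_algEquiv e₁
  rw [pow_succ] at e
  have hiso := WeaklyIsomorphic.map_algEquiv
    (tensorGrading (tensorGrading (tensorPowerGrading gradingM2four k) gradingCtwo) gradingH)
    (e₂.trans e.symm)
  exact ⟨_, inferInstance, _, hiso.isDivisionGrading (isDivisionGrading_tensor_gradingH k),
    hiso.finrank_eq (finrank_tensor_gradingH k)⟩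

theorem IsDivisionGrading.exists_weaklyIsomorphic {G R : Type*} [AddCommGroup G] [Ring R]
    [Algebra ℝ R] [FiniteDimensional ℝ R] {𝒜 : G → Submodule ℝ R} (h : IsDivisionGrading 𝒜)
    (h4 : ∀ g, Module.finrank ℝ (𝒜 g) = 4) {J : R} (hJ : IsCentralImaginaryUnit J) :
    ∃ k : ℕ, Nonempty (R ≃ₐ[ℝ] Matrix (Fin (2 ^ (k + 1))) (Fin (2 ^ (k + 1))) ℂ) ∧
      (WeaklyIsomorphic 𝒜
          (tensorGrading (tensorGrading (tensorPowerGrading gradingM2four k) gradingCtwo)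
            gradingH) ∨
        (1 ≤ k ∧ WeaklyIsomorphic 𝒜
          (tensorGrading (tensorGrading gradingM2eight (tensorPowerGrading gradingM2four (k - 1)))
            gradingH))) := by
  have hne (g : G) : 𝒜 g ≠ ⊥ := by
    rw [← Submodule.one_le_finrank_iff, h4]
    norm_num
  have := h.finite hne
  obtain ⟨C, 𝒞, J', h𝒞, hJ', hiso⟩ := h.exists_weaklyIsomorphic_tensor_gradingH h4 hJ
  obtain ⟨k, h𝒞iso | h𝒞iso⟩ := h𝒞.exists_weaklyIsomorphic hJ'
  · have hmodel := hiso.trans (h𝒞iso.tensor (.refl gradingH))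
    obtain ⟨e₁⟩ := nonempty_tensorPower_matrixTwo_algEquiv k
    obtain ⟨e₂⟩ := nonempty_tensor_complex_tensor_quaternion_algEquiv e₁
    obtain ⟨φ, -⟩ := id hmodel
    refine ⟨k, ?_, .inl hmodel⟩
    rw [pow_succ]
    exact ⟨φ.trans e₂⟩
  · have hmodel := hiso.trans (h𝒞iso.tensor (.refl gradingH))
    obtain ⟨e₁⟩ := nonempty_tensorPower_matrixTwo_algEquiv k
    obtain ⟨e₂⟩ := nonempty_matrixTwo_tensor_tensor_quaternion_algEquiv e₁
    obtain ⟨φ, -⟩ := id hmodel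
    refine ⟨k + 1, ?_, .inr ⟨k.succ_pos, hmodel⟩⟩
    rw [pow_succ, pow_succ]
    exact ⟨φ.trans e₂⟩

end QuaternionicClassification

theorem mainTheorem7_general {R : Type*} [Ring R] [Algebra ℝ R] [FiniteDimensional ℝ R] {J : R}
    (hJ : IsCentralImaginaryUnit J) :
    ((∃ (G : Type) (_ : AddCommGroup G) (𝒜 : G → Submodule ℝ R),
        IsDivisionGrading 𝒜 ∧ ∀ g, Module.finrank ℝ (𝒜 g) = 4) ↔
      ∃ m : ℕ, 1 ≤ m ∧ Nonempty (R ≃ₐ[ℝ] Matrix (Fin (2 ^ m)) (Fin (2 ^ m)) ℂ)) ∧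
    ∀ (G : Type*) [AddCommGroup G] (𝒜 : G → Submodule ℝ R),
      IsDivisionGrading 𝒜 → (∀ g, Module.finrank ℝ (𝒜 g) = 4) →
      (∃ f : ℍ[ℝ] →ₐ[ℝ] R, Function.Injective f ∧ LinearMap.range f.toLinearMap = 𝒜 0) ∧
      ∃ k : ℕ, Nonempty (R ≃ₐ[ℝ] Matrix (Fin (2 ^ (k + 1))) (Fin (2 ^ (k + 1))) ℂ) ∧
        (WeaklyIsomorphic 𝒜
            (tensorGrading (tensorGrading (tensorPowerGrading gradingM2four k) gradingCtwo)
              gradingH) ∨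
          (1 ≤ k ∧
            WeaklyIsomorphic 𝒜
              (tensorGrading
                (tensorGrading gradingM2eight (tensorPowerGrading gradingM2four (k - 1)))
                gradingH))) := by
  refine ⟨⟨?_, ?_⟩, fun G _ 𝒜 h h4 => ⟨h.exists_quaternion_algHom (h4 0),
    h.exists_weaklyIsomorphic h4 hJ⟩⟩
  · rintro ⟨G, _, 𝒜, h, h4⟩
    obtain ⟨k, e, -⟩ := h.exists_weaklyIsomorphic h4 hJ
    exact ⟨k + 1, k.succ_pos, e⟩
  · rintro ⟨m, hm, ⟨e⟩⟩
    obtain ⟨k, rfl⟩ := Nat.exists_eq_add_of_le' hm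
    exact exists_isDivisionGrading_finrank_eq_four e

theorem mainTheorem7 (n : ℕ) :
    ((∃ (G : Type) (_ : AddCommGroup G) (𝒜 : G → Submodule ℝ (Matrix (Fin n) (Fin n) ℂ)),
        IsDivisionGrading 𝒜 ∧ ∀ g, Module.finrank ℝ (𝒜 g) = 4) ↔
      ∃ m : ℕ, 1 ≤ m ∧ n = 2 ^ m) ∧
    ∀ (G : Type*) [AddCommGroup G] (𝒜 : G → Submodule ℝ (Matrix (Fin n) (Fin n) ℂ)),
      IsDivisionGrading 𝒜 → (∀ g, Module.finrank ℝ (𝒜 g) = 4) →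
      (∃ f : ℍ[ℝ] →ₐ[ℝ] Matrix (Fin n) (Fin n) ℂ,
        Function.Injective f ∧ LinearMap.range f.toLinearMap = 𝒜 0) ∧
      ∃ k : ℕ, n = 2 ^ (k + 1) ∧
        (WeaklyIsomorphic 𝒜
            (tensorGrading (tensorGrading (tensorPowerGrading gradingM2four k) gradingCtwo)
              gradingH) ∨
          (1 ≤ k ∧
            WeaklyIsomorphic 𝒜
              (tensorGrading
                (tensorGrading gradingM2eight (tensorPowerGrading gradingM2four (k - 1)))
                gradingH))) := by
  simpa only [nonempty_matrix_complex_algEquiv_iff] using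
    mainTheorem7_general (isCentralImaginaryUnit_matrix n)
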